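/- Let $s\ge 2$, $n=s^2$, and let $G$ be the $s\times s$ square grid graph with anonymous nodes, in which the edges incident to each node $v$ are numbered by the ports $1,\dots,\deg v$ (the two port numbers of an edge being unrelated). Suppose that $G$ is oriented: at every node of degree $4$, a robot that entered through port $p$ goes straight on by leaving through the port $p+2$ (modulo $4$). There are $k\le n$ robots with pairwise distinct identifiers of $O(\log k)$ bits, placed arbitrarily on the nodes (several robots may share a node). Robots know $n$ and all run the same deterministic program in synchronous rounds. In each round a robot sees the degree of its node, the port through which it has just entered (if it moved in the previous round), its own memory, and the memories of the other robots at the same node; it then updates its memory and either stays or leaves through a port of its choice, arriving at the corresponding neighbour before the next round. A robot may also terminate, after which it stays put forever. At most $f\le k$ robots crash, each at an arbitrary time; a crashed robot is from then on absent and invisible to the others. Then dispersion can be solved deterministically in $O(\sqrt n)$ rounds with $O(\log n)$ bits of memory per robot (including its identifier). That is, for each constant $c$ there is a constant $C$ such that for every such $n$ there is a program using at most $C\log_2 n$ bits of memory per robot with the following property. For every oriented port numbering of the grid, all $f\le k\le n$, all distinct identifiers whose binary length is at most $c$ times that of $k$, every initial placement, and every pattern of at most $f$ crashes, from round $C\sqrt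 n$ on all robots that have not crashed have terminated and no two of them are at the same node. -/

import Mathlib

/-- The `s × s` square grid: two nodes are adjacent iff they agree in one coordinate and are
consecutive in the other one. -/
def grid (s : ℕ) : SimpleGraph (Fin s × Fin s) :=
  (SimpleGraph.pathGraph s).boxProd (SimpleGraph.pathGraph s)

theorem grid_adj {s : ℕ} (u v : Fin s × Fin s) :
    (grid s).Adj u v ↔
      (((u.1 : ℕ) + 1 = v.1 ∨ (v.1 : ℕ) + 1 = u.1) ∧ u.2 = v.2) ∨
        (((u.2 : ℕ) + 1 = v.2 ∨ (v.2 : ℕ) + 1 = u.2) ∧ u.1 = v.1) := by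
  simp [grid, SimpleGraph.boxProd_adj, SimpleGraph.pathGraph_adj]

noncomputable instance gridLocallyFinite (s : ℕ) : (grid s).LocallyFinite :=
  fun _ => Fintype.ofFinite _

/-- A port labelling: at every node `v` the incident edges are numbered bijectively by the
`deg v` port numbers. Ports are numbered from `0`: the element `p` of `Fin (deg v)` stands for the
port number `p + 1` in `[1, deg v]`. The two port numbers of an edge are unrelated. -/
structure PortLabeling {V : Type*} (G : SimpleGraph V) [G.LocallyFinite] where
  /-- `nbr v p` is the neighbour of `v` reached through port `p` of `v`. -/
  nbr : ∀ v : V, Fin (G.degree v) ≃ G.neighborSet v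

/-- `u`, `v`, `w` lie on a line in this order with `v` the midpoint of `u` and `w`; for neighbours
`u`, `w` of `v` this says that the walk `u → v → w` goes straight on at `v`. -/
def Straight {s : ℕ} (u v w : Fin s × Fin s) : Prop :=
  (u.1 : ℕ) + w.1 = 2 * v.1 ∧ (u.2 : ℕ) + w.2 = 2 * v.2

/-- The labelled grid is oriented: at every internal node (degree `4`), the port through which a
robot goes straight on is the second one, in cyclic order, after the port through which it came in.
Equivalently the ports `1, 2, 3, 4` stand in (clockwise or counterclockwise) cyclic order around
every internal node. The order may start anywhere and may differ from node to node, and nothing is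
asked of the nodes of degree `2` and `3`. -/
def PortLabeling.Oriented {s : ℕ} (L : PortLabeling (grid s)) : Prop :=
  ∀ v, (grid s).degree v = 4 → ∀ p q : Fin ((grid s).degree v),
    Straight (L.nbr v p : Fin s × Fin s) v (L.nbr v q) ↔ (q : ℕ) = ((p : ℕ) + 2) % 4

/-- The contents of a memory of `b` bits. -/
abbrev Memory (b : ℕ) : Type := Fin b → Bool

/-- A deterministic program for robots with `b` bits of memory; all robots run the same program.
The memory is all that a robot carries from one round to the next one; in particular the robot's
identifier is available only as far as it is stored there. -/
structure RobotProgram (b : ℕ) where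
  /-- The initial memory contents of a robot, as a function of its identifier. -/
  init : ℕ → Memory b
  /-- The memory contents in which a robot has terminated. -/
  halted : Memory b → Bool
  /-- One round. The arguments are the degree `δ` of the current node, the port through which the
  robot entered the node in the round before (`none` if it did not move in that round), its
  own memory, and the memories of the other robots at the node. The result is the new memory and
  the port through which to leave (`none` to stay). -/
  step : (δ : ℕ) → Option (Fin δ) → Memory b → Multiset (Memory b) → Memory b × Option (Fin δ)

/-- The state of one robot at the beginning of a round. -/
structure RobotState {V : Type*} (G : SimpleGraph V) [G.LocallyFinite] (b : ℕ) where
  /-- The current node. -/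
  node : V
  /-- The port of `node` through which the robot entered it in the round before, if it moved. -/
  inPort : Option (Fin (G.degree node))
  /-- The memory contents. -/
  mem : Memory b

section Execution

variable {V : Type*} {G : SimpleGraph V} [G.LocallyFinite] {b k : ℕ}

/-- Robot `i` has not crashed when round `t` begins. Here `crash i` is the first round in which
robot `i` takes no part any more, and `⊤` if it never crashes. -/
def Alive (crash : Fin k → ℕ∞) (t : ℕ) (i : Fin k) : Prop := (t : ℕ∞) < crash i

/-- Robot state after leaving the node `v` through the port `p` of `v`, with new memory `m`. -/
def RobotState.moveTo (L : PortLabeling G) (v : V) (p : Fin (G.degree v)) (m : Memory b) :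
    RobotState G b where
  node := L.nbr v p
  inPort := some ((L.nbr (L.nbr v p)).symm ⟨v, (L.nbr v p).2.symm⟩)
  mem := m

open Classical in
/-- The memories that robot `i` sees in round `t`: those of the other robots at its node that have
not crashed. -/
noncomputable def visible (crash : Fin k → ℕ∞) (t : ℕ) (S : Fin k → RobotState G b) (i : Fin k) :
    Multiset (Memory b) :=
  (Finset.univ.filter fun j => j ≠ i ∧ Alive crash t j ∧ (S j).node = (S i).node).val.map
    fun j => (S j).mem

open Classical in
/-- One synchronous Communicate-Compute-Move round: from the states at the beginning of round `t`
to the states at the beginning of round `t + 1`. A robot that has crashed or terminated does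
nothing; a terminated robot stays visible at its node, a crashed one does not. -/
noncomputable def nextRound (L : PortLabeling G) (A : RobotProgram b) (crash : Fin k → ℕ∞) (t : ℕ)
    (S : Fin k → RobotState G b) (i : Fin k) : RobotState G b :=
  if Alive crash t i ∧ A.halted (S i).mem = false then
    match A.step (G.degree (S i).node) (S i).inPort (S i).mem (visible crash t S i) with
    | (m, none) => { node := (S i).node, inPort := none, mem := m }
    | (m, some p) => RobotState.moveTo L (S i).node p m
  else S i

/-- The states of the `k` robots at the beginning of round `t`, when robot `i` has the identifier
`ident i` and starts at the node `start i`. -/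
noncomputable def execution (L : PortLabeling G) (A : RobotProgram b) (ident : Fin k → ℕ)
    (start : Fin k → V) (crash : Fin k → ℕ∞) : ℕ → Fin k → RobotState G b
  | 0 => fun i => { node := start i, inPort := none, mem := A.init (ident i) }
  | t + 1 => nextRound L A crash t (execution L A ident start crash t)

/-- Dispersion is achieved when round `t` begins: all robots that have not crashed have terminated
and no two of them are at the same node. -/
def DispersedAt (A : RobotProgram b) (crash : Fin k → ℕ∞) (t : ℕ)
    (S : Fin k → RobotState G b) : Prop :=
  (∀ i, Alive crash t i → A.halted (S i).mem = true) ∧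
    ∀ i j, Alive crash t i → Alive crash t j → (S i).node = (S j).node → i = j

end Execution

/-! Every boundary node serves as a station. The robot of rank `r` at a station is sent to the node
obtained by moving each wall coordinate `r` steps inwards: along the perpendicular from a side,
along the diagonal from a corner. The rank is the depth of the target, so targets determine station
and rank (`isTarget_inj`). With the ranks below `cap`, all nodes are reached except the centre for
odd `s` (`exists_station`). Hence the capacities add up to at least `n - s % 2`.

During the first `30 * s` rounds each robot goes straight to the boundary and tours it. At a node of
degree 3 entered along the boundary, one of the two other ports leads on and the other leads inside.
A wrong guess shows degree 4 and is undone, so an advance costs at most three rounds (`probe_first`,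
`probe_second`), whatever the port numbers are. From the first corner on, a robot knows its distance
from the last corner and hence the capacity of its station. It is taken in if the living residents
and the simultaneous arrivals with smaller identifiers leave a place for it.

Crashes are handled by two different counts (`TourGlobal.succ`). Living residents never exceed the
capacity, so their ranks are admissible. After a robot has been turned away, the residents ever
taken in, crashed ones included, are at least as many as the capacity, and this number never drops.
A robot turned away everywhere thus accounts for at least `n - s % 2` other robots (`le_card_res`).
As `k ≤ n`, there is at most one such robot, and only for odd `s` (`left_unique`); it is sent to the
centre.

In round `30 * s` ranks by identifier fix distinct targets (`exists_targets`). From then on robots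
ignore each other, so crashes do no harm. A robot from a corner first walks `r` steps along a side.
Then every robot finds the inward port by trial and goes straight on by orientation.

The program is written over a record with an identifier, a mode and four counters of size `O(s)`.
`isRun_confOf` transfers it to bit memories, and `exists_encoding` supplies the encoding. -/

/-! ### Ports as natural numbers -/

section Ports

variable {V : Type*} {G : SimpleGraph V} [G.LocallyFinite]

open Classical in
/-- The neighbour of `v` behind port `p` (`v` itself if there is no such port). -/
noncomputable def PortLabeling.nb (L : PortLabeling G) (v : V) (p : ℕ) : V :=
  if h : p < G.degree v then (L.nbr v ⟨p, h⟩ : V) else v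

open Classical in
/-- The number of the port of `v` that leads to the neighbour `w`. -/
noncomputable def PortLabeling.pt (L : PortLabeling G) (v w : V) : ℕ :=
  if h : G.Adj v w then ((L.nbr v).symm ⟨w, h⟩ : ℕ) else 0

theorem PortLabeling.pt_lt (L : PortLabeling G) {v w : V} (h : G.Adj v w) :
    L.pt v w < G.degree v := by
  simp [PortLabeling.pt, h]

theorem PortLabeling.nb_pt (L : PortLabeling G) {v w : V} (h : G.Adj v w) :
    L.nb v (L.pt v w) = w := by
  have := L.pt_lt h
  unfold PortLabeling.nb
  rw [dif_pos this]
  simp [PortLabeling.pt, h]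

theorem PortLabeling.adj_nb (L : PortLabeling G) {v : V} {p : ℕ} (h : p < G.degree v) :
    G.Adj v (L.nb v p) := by
  unfold PortLabeling.nb
  rw [dif_pos h]
  exact (L.nbr v ⟨p, h⟩).2

theorem PortLabeling.pt_nb (L : PortLabeling G) {v : V} {p : ℕ} (h : p < G.degree v) :
    L.pt v (L.nb v p) = p := by
  have h1 := L.adj_nb h
  unfold PortLabeling.pt
  rw [dif_pos h1]
  have : (⟨L.nb v p, h1⟩ : G.neighborSet v) = L.nbr v ⟨p, h⟩ := by
    apply Subtype.ext
    simp [PortLabeling.nb, h]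
  rw [this]
  simp

theorem PortLabeling.pt_inj (L : PortLabeling G) {v w w' : V} (h : G.Adj v w) (h' : G.Adj v w')
    (e : L.pt v w = L.pt v w') : w = w' := by
  rw [← L.nb_pt h, ← L.nb_pt h', e]

end Ports

/-! ### Programs over a structured memory -/

/-- What a robot is doing. -/
inductive Mode
  | out | fresh | ret | res | left | ffresh | fret | ftry | fback | fgo | done
  deriving DecidableEq

instance : Fintype Mode where
  elems := {.out, .fresh, .ret, .res, .left, .ffresh, .fret, .ftry, .fback, .fgo, .done}
  complete x := by cases x <;> simp

/-- Structured memory contents. -/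
@[ext]
structure Mem where
  /-- identifier -/
  id : ℕ
  /-- number of the round -/
  clk : ℕ
  /-- current task -/
  mode : Mode
  /-- a port number -/
  c : ℕ
  /-- a step counter -/
  x : ℕ
  /-- a second step counter -/
  pos : ℕ

/-- A robot state with structured memory and a natural number as entry port. -/
@[ext]
structure Conf (V : Type*) where
  /-- current node -/
  node : V
  /-- entry port -/
  inp : Option ℕ
  /-- memory -/
  mem : Mem

open Classical in
/-- The effect of leaving `v` through a port, or of staying. -/
noncomputable def applyMove {V : Type*} {G : SimpleGraph V} [G.LocallyFinite]
    (L : PortLabeling G) (v : V) (r : Mem × Option ℕ) : Conf V :=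
  match r.2 with
  | none => ⟨v, none, r.1⟩
  | some p => if p < G.degree v then ⟨L.nb v p, some (L.pt (L.nb v p) v), r.1⟩
      else ⟨v, none, r.1⟩

/-- A program over structured memories, run on bit memories through an encoding. -/
def liftProgram {b : ℕ} (enc : Mem → Memory b) (dec : Memory b → Mem) (ini : ℕ → Mem)
    (halt : Mem → Bool) (stp : ℕ → Option ℕ → Mem → Multiset Mem → Mem × Option ℕ) :
    RobotProgram b where
  init i := enc (ini i)
  halted μ := halt (dec μ)
  step δ inp μ others :=
    let r := stp δ (inp.map Fin.val) (dec μ) (others.map dec)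
    (enc r.1, r.2.bind fun p => if h : p < δ then some ⟨p, h⟩ else none)

section Lift

variable {V : Type*} {G : SimpleGraph V} [G.LocallyFinite] {b k : ℕ}

/-- The structured view of a robot state. -/
def confOf (dec : Memory b → Mem) (S : RobotState G b) : Conf V :=
  ⟨S.node, S.inPort.map Fin.val, dec S.mem⟩

open Classical in
/-- The structured memories of the other robots at the node of robot `i`. -/
noncomputable def others (crash : Fin k → ℕ∞) (t : ℕ) (σ : Fin k → Conf V) (i : Fin k) :
    Multiset Mem :=
  (Finset.univ.filter fun j => j ≠ i ∧ Alive crash t j ∧ (σ j).node = (σ i).node).val.map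
    fun j => (σ j).mem

/-- The sequence `σ` of configurations is a run of the structured program. -/
structure IsRun (L : PortLabeling G) (ini : ℕ → Mem) (halt : Mem → Bool)
    (stp : ℕ → Option ℕ → Mem → Multiset Mem → Mem × Option ℕ)
    (ident : Fin k → ℕ) (start : Fin k → V) (crash : Fin k → ℕ∞)
    (σ : ℕ → Fin k → Conf V) : Prop where
  zero : ∀ i, σ 0 i = ⟨start i, none, ini (ident i)⟩
  frozen : ∀ t i, ¬ (Alive crash t i ∧ halt (σ t i).mem = false) → σ (t + 1) i = σ t i
  step : ∀ t i, Alive crash t i → halt (σ t i).mem = false →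
    σ (t + 1) i = applyMove L (σ t i).node
      (stp (G.degree (σ t i).node) (σ t i).inp (σ t i).mem (others crash t (σ t) i))

/-- Decoding commutes with one round as soon as the new memory survives encoding. A port that does
not exist at the node means staying, for both kinds of program. -/
theorem confOf_nextRound (L : PortLabeling G) (enc : Mem → Memory b) (dec : Memory b → Mem)
    (ini : ℕ → Mem) (halt : Mem → Bool)
    (stp : ℕ → Option ℕ → Mem → Multiset Mem → Mem × Option ℕ) (crash : Fin k → ℕ∞) (t : ℕ)
    (S : Fin k → RobotState G b) (i : Fin k) (r : Mem × Option ℕ)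
    (hr : stp (G.degree (S i).node) (confOf dec (S i)).inp (confOf dec (S i)).mem
      (others crash t (fun j => confOf dec (S j)) i) = r)
    (hrt : dec (enc r.1) = r.1)
    (ha : Alive crash t i) (hh : halt (dec (S i).mem) = false) :
    confOf dec (nextRound L (liftProgram enc dec ini halt stp) crash t S i) =
      applyMove L (S i).node r := by
  have hvis : (visible crash t S i).map dec = others crash t (fun j => confOf dec (S j)) i := by
    unfold visible others
    rw [Multiset.map_map]
    rfl
  unfold nextRound
  rw [if_pos ⟨ha, hh⟩]
  have hstep : (liftProgram enc dec ini halt stp).step (G.degree (S i).node) (S i).inPort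
      (S i).mem (visible crash t S i) =
      (enc r.1, r.2.bind fun p => if h : p < G.degree (S i).node then some ⟨p, h⟩ else none) := by
    simp only [liftProgram]
    rw [hvis]
    simp only [confOf] at hr ⊢
    rw [hr]
  obtain ⟨m, o⟩ := r
  cases o with
  | none =>
    rw [hstep]
    change Conf.mk _ _ (dec (enc m)) = _
    rw [hrt]
    rfl
  | some p =>
    by_cases hp : p < G.degree (S i).node
    · have h1 := L.adj_nb hp
      have h2 : L.nb (S i).node p = (L.nbr (S i).node ⟨p, hp⟩ : V) := by
        simp [PortLabeling.nb, hp]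
      rw [hstep]
      simp only [Option.bind_some, dif_pos hp]
      change Conf.mk (L.nbr (S i).node ⟨p, hp⟩ : V) (some
        (((L.nbr (L.nbr (S i).node ⟨p, hp⟩)).symm ⟨(S i).node, _⟩ : Fin _) : ℕ)) (dec (enc m)) = _
      simp only [applyMove, if_pos hp, h2]
      rw [hrt]
      unfold PortLabeling.pt
      rw [dif_pos (h2 ▸ h1.symm)]
    · rw [hstep]
      simp only [Option.bind_some, dif_neg hp]
      change Conf.mk _ _ (dec (enc m)) = _
      rw [hrt]
      simp [applyMove, hp]

/-- An execution of a lifted program is a run of the structured program, provided that the encoding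
is faithful on an invariant set of memories. -/
theorem isRun_confOf (L : PortLabeling G) (enc : Mem → Memory b) (dec : Memory b → Mem)
    (ini : ℕ → Mem) (halt : Mem → Bool)
    (stp : ℕ → Option ℕ → Mem → Multiset Mem → Mem × Option ℕ)
    (ident : Fin k → ℕ) (start : Fin k → V) (crash : Fin k → ℕ∞) (Good : Mem → Prop)
    (henc : ∀ m, Good m → dec (enc m) = m) (hini : ∀ i, Good (ini (ident i)))
    (hstp : ∀ (v : V) inp m o, (∀ p ∈ inp, p < G.degree v) → Good m → halt m = false →
      Good (stp (G.degree v) inp m o).1) :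
    IsRun L ini halt stp ident start crash (fun t i => confOf dec
      (execution L (liftProgram enc dec ini halt stp) ident start crash t i)) := by
  set E := execution L (liftProgram enc dec ini halt stp) ident start crash with hE
  have hz : ∀ i, confOf dec (E 0 i) = ⟨start i, none, ini (ident i)⟩ := by
    intro i
    change Conf.mk _ _ (dec (enc (ini (ident i)))) = _
    rw [henc _ (hini i)]
    rfl
  have hs : ∀ t i, E (t + 1) i = nextRound L (liftProgram enc dec ini halt stp) crash t (E t) i :=
    fun t i => rfl
  -- Entry ports may be stored, so their bound is needed to keep the memory within the invariant.
  have hinp : ∀ t i, ∀ p ∈ (confOf dec (E t i)).inp, p < G.degree (E t i).node := by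
    intro t i p hp
    simp only [confOf, Option.mem_def, Option.map_eq_some_iff] at hp
    obtain ⟨a, -, rfl⟩ := hp
    exact a.2
  have hgood : ∀ t i, Good (dec (E t i).mem) := by
    intro t
    induction t with
    | zero => intro i; have := hz i; simp only [confOf, Conf.mk.injEq] at this; rw [this.2.2]; exact hini i
    | succ t ih =>
      intro i
      by_cases h : Alive crash t i ∧ halt (dec (E t i).mem) = false
      · have hg := hstp (E t i).node (confOf dec (E t i)).inp (confOf dec (E t i)).mem
          (others crash t (fun j => confOf dec (E t j)) i) (hinp t i) (ih i) h.2
        have := confOf_nextRound L enc dec ini halt stp crash t (E t) i _ rfl (henc _ hg) h.1 h.2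
        rw [hs]
        have h2 := congrArg Conf.mem this
        simp only [confOf] at h2
        rw [h2]
        unfold applyMove
        split
        · exact hg
        · split
          · exact hg
          · exact hg
      · have hn : E (t + 1) i = E t i := by rw [hs]; exact if_neg h
        rw [hn]
        exact ih i
  refine ⟨hz, ?_, ?_⟩
  · intro t i h
    have hn : E (t + 1) i = E t i := by rw [hs]; exact if_neg h
    change confOf dec (E (t + 1) i) = _
    rw [hn]
  · intro t i ha hh
    have hg := hstp (E t i).node (confOf dec (E t i)).inp (confOf dec (E t i)).mem
      (others crash t (fun j => confOf dec (E t j)) i) (hinp t i) (hgood t i) hh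
    exact confOf_nextRound L enc dec ini halt stp crash t (E t) i _ rfl (henc _ hg) ha hh

end Lift

/-! ### Geometry of the grid -/

/-- Boundary nodes of the grid. -/
def OnB {s : ℕ} (v : Fin s × Fin s) : Prop :=
  (v.1 : ℕ) = 0 ∨ (v.1 : ℕ) + 1 = s ∨ (v.2 : ℕ) = 0 ∨ (v.2 : ℕ) + 1 = s

/-- Corners of the grid. -/
def Corner {s : ℕ} (v : Fin s × Fin s) : Prop :=
  ((v.1 : ℕ) = 0 ∨ (v.1 : ℕ) + 1 = s) ∧ ((v.2 : ℕ) = 0 ∨ (v.2 : ℕ) + 1 = s)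

theorem Corner.onB {s : ℕ} {v : Fin s × Fin s} (h : Corner v) : OnB v := by
  unfold Corner at h; unfold OnB; tauto

theorem pathGraph_degree {s : ℕ} (hs : 2 ≤ s) (v : Fin s)
    [Fintype ((SimpleGraph.pathGraph s).neighborSet v)] :
    (SimpleGraph.pathGraph s).degree v =
      if (v : ℕ) = 0 ∨ (v : ℕ) + 1 = s then 1 else 2 := by
  classical
  have hv := v.2
  have key : (SimpleGraph.pathGraph s).neighborFinset v =
      Finset.univ.filter fun w : Fin s => (v : ℕ) + 1 = w ∨ (w : ℕ) + 1 = v := by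
    ext w
    simp [SimpleGraph.pathGraph_adj]
  unfold SimpleGraph.degree
  rw [key]
  split_ifs with h
  · rw [Finset.card_eq_one]
    rcases h with h | h
    · refine ⟨⟨1, by omega⟩, ?_⟩
      ext w
      simp only [Finset.mem_filter, Finset.mem_univ, true_and, Finset.mem_singleton, Fin.ext_iff]
      omega
    · refine ⟨⟨v - 1, by omega⟩, ?_⟩
      ext w
      have := w.2
      simp only [Finset.mem_filter, Finset.mem_univ, true_and, Finset.mem_singleton, Fin.ext_iff]
      omega
  · rw [Finset.card_eq_two]
    refine ⟨⟨v - 1, by omega⟩, ⟨v + 1, by omega⟩, ?_, ?_⟩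
    · simp only [ne_eq, Fin.mk.injEq]; omega
    · ext w
      simp only [Finset.mem_filter, Finset.mem_univ, true_and, Finset.mem_singleton,
        Finset.mem_insert, Fin.ext_iff]
      omega

theorem grid_degree {s : ℕ} (hs : 2 ≤ s) (v : Fin s × Fin s) :
    (grid s).degree v = (if (v.1 : ℕ) = 0 ∨ (v.1 : ℕ) + 1 = s then 1 else 2) +
      (if (v.2 : ℕ) = 0 ∨ (v.2 : ℕ) + 1 = s then 1 else 2) := by
  classical
  have h1 : Fintype ((SimpleGraph.pathGraph s).neighborSet v.1) := Fintype.ofFinite _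
  have h2 : Fintype ((SimpleGraph.pathGraph s).neighborSet v.2) := Fintype.ofFinite _
  have h3 : Fintype (((SimpleGraph.pathGraph s).boxProd
    (SimpleGraph.pathGraph s)).neighborSet v) := Fintype.ofFinite _
  rw [← pathGraph_degree hs v.1, ← pathGraph_degree hs v.2, ← SimpleGraph.degree_boxProd v]
  -- The two degrees differ only in their `Fintype` instances.
  rw [← SimpleGraph.card_neighborSet_eq_degree, ← SimpleGraph.card_neighborSet_eq_degree]
  exact Fintype.card_congr (Equiv.refl _)

/-- Classification of the nodes by degree. -/
theorem grid_degree_cases {s : ℕ} (hs : 2 ≤ s) (v : Fin s × Fin s) :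
    ((grid s).degree v = 4 ∧ ¬ OnB v ∧ ¬ Corner v) ∨
    ((grid s).degree v = 3 ∧ OnB v ∧ ¬ Corner v) ∨
      ((grid s).degree v = 2 ∧ OnB v ∧ Corner v) := by
  rw [grid_degree hs]
  unfold OnB Corner
  split_ifs <;> omega

theorem grid_degree_eq_four {s : ℕ} (hs : 2 ≤ s) {v : Fin s × Fin s} :
    (grid s).degree v = 4 ↔ ¬ OnB v := by
  have := grid_degree_cases hs v
  grind

theorem grid_degree_eq_two {s : ℕ} (hs : 2 ≤ s) {v : Fin s × Fin s} :
    (grid s).degree v = 2 ↔ Corner v := by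
  have := grid_degree_cases hs v
  grind

theorem grid_adj_coord {s : ℕ} {u v : Fin s × Fin s} (h : (grid s).Adj u v) :
    (((u.1 : ℕ) + 1 = v.1 ∨ (v.1 : ℕ) + 1 = u.1) ∧ (u.2 : ℕ) = v.2) ∨
      (((u.2 : ℕ) + 1 = v.2 ∨ (v.2 : ℕ) + 1 = u.2) ∧ (u.1 : ℕ) = v.1) := by
  rw [grid_adj] at h
  simpa [Fin.ext_iff] using h

theorem node_ext {s : ℕ} {u v : Fin s × Fin s} (h1 : (u.1 : ℕ) = v.1) (h2 : (u.2 : ℕ) = v.2) :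
    u = v :=
  Prod.ext (Fin.ext h1) (Fin.ext h2)

theorem node_ne {s : ℕ} {u v : Fin s × Fin s} (h : u ≠ v) :
    (u.1 : ℕ) ≠ v.1 ∨ (u.2 : ℕ) ≠ v.2 := by
  by_contra! h'
  exact h (node_ext h'.1 h'.2)

/-- Going straight on at an internal node of an oriented grid. -/
theorem PortLabeling.Oriented.straight_nb {s : ℕ} {L : PortLabeling (grid s)} (hL : L.Oriented)
    {u v : Fin s × Fin s} (hv : (grid s).degree v = 4) (h : (grid s).Adj v u) :
    (L.pt v u + 2) % 4 < (grid s).degree v ∧ Straight u v (L.nb v ((L.pt v u + 2) % 4)) := by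
  have h1 : (L.pt v u + 2) % 4 < (grid s).degree v := by rw [hv]; omega
  refine ⟨h1, ?_⟩
  have := (hL v hv ⟨L.pt v u, L.pt_lt h⟩ ⟨_, h1⟩).2 rfl
  have e1 := L.nb_pt h
  unfold PortLabeling.nb at e1 ⊢
  rw [dif_pos (L.pt_lt h)] at e1
  rw [dif_pos h1]
  rwa [e1] at this

/-- An internal neighbour of a boundary node is unique. -/
theorem inner_unique {s : ℕ} {v u w : Fin s × Fin s} (hv : OnB v)
    (hu : (grid s).Adj v u) (hw : (grid s).Adj v w) (hu' : ¬ OnB u) (hw' : ¬ OnB w) : u = w := by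
  have h1 := grid_adj_coord hu
  have h2 := grid_adj_coord hw
  unfold OnB at *
  exact node_ext (by omega) (by omega)

theorem Corner.onB_of_adj {s : ℕ} {v u : Fin s × Fin s} (hv : Corner v)
    (hu : (grid s).Adj v u) : OnB u := by
  have h1 := grid_adj_coord hu
  unfold OnB Corner at *
  omega

/-! ### Walking around the boundary -/

/-- Index of the boundary node `(x, y)` of the square of side `m`, along the boundary. -/
def bidx (m x y : ℕ) : ℕ :=
  if y = 0 ∧ x < m then x else if x = m ∧ y < m then m + y
  else if y = m ∧ 0 < x then 3 * m - x else 4 * m - y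

/-- Distance of the boundary node `(x, y)` from the last corner, along the boundary. -/
def boff (m x y : ℕ) : ℕ :=
  if y = 0 ∧ x < m then x else if x = m ∧ y < m then y
  else if y = m ∧ 0 < x then m - x else m - y

/-- `bidx` in one of the two directions. -/
def dirIdx {s : ℕ} (d : Bool) (v : Fin s × Fin s) : ℕ :=
  if d then bidx (s - 1) v.1 v.2 else bidx (s - 1) v.2 v.1

/-- `boff` in one of the two directions. -/
def dirOff {s : ℕ} (d : Bool) (v : Fin s × Fin s) : ℕ :=
  if d then boff (s - 1) v.1 v.2 else boff (s - 1) v.2 v.1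

/-- A side-by-side linear description of index and offset, which leaves the later facts to `omega`.
Direction `false` is the reflection in the main diagonal. -/
theorem dir_cases {s : ℕ} (hs : 2 ≤ s) (d : Bool) {v : Fin s × Fin s} (hv : OnB v) :
    ∃ x y : ℕ, (d = true ∧ x = v.1 ∧ y = v.2 ∨ d = false ∧ x = v.2 ∧ y = v.1) ∧
     ((y = 0 ∧ x + 1 < s ∧ dirIdx d v = x ∧ dirOff d v = x) ∨
      (x + 1 = s ∧ y + 1 < s ∧ dirIdx d v = (s - 1) + y ∧ dirOff d v = y) ∨
      (y + 1 = s ∧ 0 < x ∧ x < s ∧ dirIdx d v + x = 3 * (s - 1) ∧ dirOff d v + x + 1 = s) ∨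
      (x = 0 ∧ 0 < y ∧ y < s ∧ dirIdx d v + y = 4 * (s - 1) ∧ dirOff d v + y + 1 = s)) := by
  have h1 := v.1.2
  have h2 := v.2.2
  unfold OnB at hv
  cases d
  · refine ⟨v.2, v.1, by simp, ?_⟩
    simp only [dirIdx, dirOff, bidx, boff, Bool.false_eq_true, if_false]
    split_ifs <;> omega
  · refine ⟨v.1, v.2, by simp, ?_⟩
    simp only [dirIdx, dirOff, bidx, boff, if_true]
    split_ifs <;> omega

/-- `v` follows `u` on the boundary, in direction `d`. -/
def Nxt {s : ℕ} (d : Bool) (u v : Fin s × Fin s) : Prop :=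
  dirIdx d v = dirIdx d u + 1 ∨ (dirIdx d u + 1 = 4 * (s - 1) ∧ dirIdx d v = 0)

theorem dirIdx_lt {s : ℕ} (hs : 2 ≤ s) (d : Bool) {v : Fin s × Fin s} (hv : OnB v) :
    dirIdx d v < 4 * (s - 1) := by
  obtain ⟨x, y, h, h'⟩ := dir_cases hs d hv
  omega

theorem dirIdx_inj {s : ℕ} (hs : 2 ≤ s) (d : Bool) {v w : Fin s × Fin s} (hv : OnB v)
    (hw : OnB w) (h : dirIdx d v = dirIdx d w) : v = w := by
  obtain ⟨x, y, h1, h2⟩ := dir_cases hs d hv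
  obtain ⟨x', y', h1', h2'⟩ := dir_cases hs d hw
  have : x = x' ∧ y = y' := by omega
  apply node_ext <;> grind

/-- The reflection reverses the cyclic order and fixes the corner of index 0. -/
theorem dirIdx_reverse {s : ℕ} (hs : 2 ≤ s) {v : Fin s × Fin s} (hv : OnB v) :
    dirIdx true v + dirIdx false v = 4 * (s - 1) ∨ (dirIdx true v = 0 ∧ dirIdx false v = 0) := by
  obtain ⟨x, y, h1, h2⟩ := dir_cases hs true hv
  obtain ⟨x', y', h1', h2'⟩ := dir_cases hs false hv
  simp at h1 h1'
  omega

/-- The boundary is a cycle without chords in the grid. -/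
theorem nxt_or_nxt {s : ℕ} (hs : 2 ≤ s) (d : Bool) {u v : Fin s × Fin s} (hu : OnB u)
    (hv : OnB v) (h : (grid s).Adj u v) : Nxt d u v ∨ Nxt d v u := by
  obtain ⟨x, y, h1, h2⟩ := dir_cases hs d hu
  obtain ⟨x', y', h1', h2'⟩ := dir_cases hs d hv
  have h3 : ((x + 1 = x' ∨ x' + 1 = x) ∧ y = y') ∨ ((y + 1 = y' ∨ y' + 1 = y) ∧ x = x') := by
    have := grid_adj_coord h
    cases d <;> simp at h1 h1' <;> omega
  clear h1 h1'
  unfold Nxt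
  rcases h3 with ⟨h3 | h3, h4⟩ | ⟨h3 | h3, h4⟩ <;> rcases h2 with h2 | h2 | h2 | h2 <;>
    rcases h2' with h2' | h2' | h2' | h2' <;> omega

theorem exists_nxt {s : ℕ} (hs : 2 ≤ s) {u v : Fin s × Fin s} (hu : OnB u) (hv : OnB v)
    (h : (grid s).Adj u v) : ∃ d, Nxt d u v := by
  rcases nxt_or_nxt hs true hu hv h with h1 | h1
  · exact ⟨true, h1⟩
  · refine ⟨false, ?_⟩
    have := dirIdx_reverse hs hu
    have := dirIdx_reverse hs hv
    have := dirIdx_lt hs true hu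
    have := dirIdx_lt hs true hv
    have := dirIdx_lt hs false hu
    have := dirIdx_lt hs false hv
    unfold Nxt at *
    omega

/-- A boundary node has only one predecessor on the cycle, so a robot that does not turn back keeps
its direction. -/
theorem Nxt.next {s : ℕ} (hs : 2 ≤ s) {d : Bool} {t u v : Fin s × Fin s} (ht : OnB t)
    (hu : OnB u) (hv : OnB v) (h : (grid s).Adj u v) (hn : Nxt d t u)
    (hne : v ≠ t) : Nxt d u v := by
  rcases nxt_or_nxt hs d hu hv h with h1 | h1
  · exact h1
  · refine absurd (dirIdx_inj hs d hv ht ?_) hne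
    have := dirIdx_lt hs d ht
    have := dirIdx_lt hs d hv
    unfold Nxt at *
    omega

theorem dirOff_lt {s : ℕ} (hs : 2 ≤ s) (d : Bool) {v : Fin s × Fin s} (hv : OnB v) :
    dirOff d v + 1 < s := by
  obtain ⟨x, y, h, h'⟩ := dir_cases hs d hv
  omega

theorem dirOff_corner {s : ℕ} (hs : 2 ≤ s) (d : Bool) {v : Fin s × Fin s} (hv : OnB v) :
    dirOff d v = 0 ↔ Corner v := by
  obtain ⟨x, y, h, h'⟩ := dir_cases hs d hv
  unfold Corner
  omega

theorem Nxt.dirOff {s : ℕ} (hs : 2 ≤ s) {d : Bool} {u v : Fin s × Fin s} (hu : OnB u)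
    (hv : OnB v) (hn : Nxt d u v) (hc : ¬ Corner v) : dirOff d v = dirOff d u + 1 := by
  obtain ⟨x, y, h1, h2⟩ := dir_cases hs d hu
  obtain ⟨x', y', h1', h2'⟩ := dir_cases hs d hv
  unfold Corner at hc
  unfold Nxt at hn
  omega

/-- Number of steps from `w` to `v` along the boundary in direction `d`. -/
def backDist {s : ℕ} (d : Bool) (v w : Fin s × Fin s) : ℕ :=
  if dirIdx d w ≤ dirIdx d v then dirIdx d v - dirIdx d w
  else dirIdx d v + 4 * (s - 1) - dirIdx d w

theorem backDist_lt {s : ℕ} (hs : 2 ≤ s) (d : Bool) {v w : Fin s × Fin s} (hv : OnB v)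
    (hw : OnB w) : backDist d v w < 4 * (s - 1) := by
  have := dirIdx_lt hs d hv
  have := dirIdx_lt hs d hw
  unfold backDist
  split_ifs <;> omega

/-- This lets the last `pos` visited nodes be described as those with `backDist` below `pos`: one
step shifts the window by one. -/
theorem Nxt.backDist {s : ℕ} (hs : 2 ≤ s) {d : Bool} {u v w : Fin s × Fin s} (hu : OnB u)
    (hv : OnB v) (hw : OnB w) (hn : Nxt d u v) (hne : w ≠ v) :
    backDist d u w + 1 = backDist d v w := by
  have := dirIdx_lt hs d hu
  have := dirIdx_lt hs d hv
  have := dirIdx_lt hs d hw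
  have : dirIdx d w ≠ dirIdx d v := fun h => hne (dirIdx_inj hs d hw hv h)
  unfold Nxt at hn
  unfold _root_.backDist
  split_ifs <;> omega

/-! ### Stations and their territories -/

open Classical in
/-- The number of robots that a boundary node takes in. -/
noncomputable def cap {s : ℕ} (v : Fin s × Fin s) : ℕ :=
  if Corner v then s / 2
  else if (v.1 : ℕ) = 0 ∨ (v.1 : ℕ) + 1 = s then min (v.2 : ℕ) (s - 1 - v.2)
  else min (v.1 : ℕ) (s - 1 - v.1)

/-- The capacity is symmetric in the two ends of a side, so robots touring in opposite directions
compute the same value. -/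
theorem cap_of_not_corner {s : ℕ} (hs : 2 ≤ s) (d : Bool) {v : Fin s × Fin s} (hv : OnB v)
    (hc : ¬ Corner v) : cap v = min (dirOff d v) (s - 1 - dirOff d v) := by
  obtain ⟨x, y, h, h'⟩ := dir_cases hs d hv
  unfold cap
  rw [if_neg hc]
  unfold Corner at hc
  split_ifs <;> omega

theorem cap_of_corner {s : ℕ} {v : Fin s × Fin s} (hc : Corner v) : cap v = s / 2 := if_pos hc

theorem cap_le {s : ℕ} (v : Fin s × Fin s) : cap v ≤ s / 2 := by
  have := v.1.2
  have := v.2.2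
  unfold cap
  split_ifs <;> omega

/-- Move the coordinate `x` inwards by `r` if it is at the wall. -/
def shift (s x r : ℕ) : ℕ := if x = 0 then r else if x + 1 = s then s - 1 - r else x

theorem shift_cases (s x r : ℕ) : (x = 0 ∧ shift s x r = r) ∨
    (x ≠ 0 ∧ x + 1 = s ∧ shift s x r = s - 1 - r) ∨ (x ≠ 0 ∧ x + 1 ≠ s ∧ shift s x r = x) := by
  unfold shift
  split_ifs <;> omega

/-- `w` is the node that the robot of rank `r` at station `v` is sent to. -/
def IsTarget {s : ℕ} (v : Fin s × Fin s) (r : ℕ) (w : Fin s × Fin s) : Prop :=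
  (w.1 : ℕ) = shift s v.1 r ∧ (w.2 : ℕ) = shift s v.2 r

theorem exists_isTarget {s : ℕ} (hs : 2 ≤ s) (v : Fin s × Fin s) {r : ℕ} (hr : r < s) :
    ∃ w, IsTarget v r w := by
  have h1 := shift_cases s v.1 r
  have h2 := shift_cases s v.2 r
  have := v.1.2
  have := v.2.2
  exact ⟨(⟨shift s v.1 r, by omega⟩, ⟨shift s v.2 r, by omega⟩), rfl, rfl⟩

/-- Below capacity, a coordinate that is not at a wall lies deeper than `r`. So the target has depth
exactly `r`, and one can see which of its coordinates were shifted. -/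
theorem lt_of_lt_cap {s : ℕ} {v : Fin s × Fin s} {r : ℕ} (hv : OnB v) (hr : r < cap v) :
    2 * r + 1 < s ∧
      ((v.1 : ℕ) = 0 ∨ (v.1 : ℕ) + 1 = s ∨ (r < v.1 ∧ (v.1 : ℕ) + r + 1 < s)) ∧
      ((v.2 : ℕ) = 0 ∨ (v.2 : ℕ) + 1 = s ∨ (r < v.2 ∧ (v.2 : ℕ) + r + 1 < s)) := by
  have b1 := v.1.2
  have b2 := v.2.2
  unfold cap Corner at hr
  unfold OnB at hv
  rw [lt_iff_not_ge] at hr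
  split_ifs at hr <;> refine ⟨?_, ?_, ?_⟩ <;> omega

/-- A target determines its station and rank. -/
theorem IsTarget.spec {s : ℕ} {v w : Fin s × Fin s} {r : ℕ} (hv : OnB v)
    (hr : r < cap v) (h : IsTarget v r w) :
    r = min (min (w.1 : ℕ) (s - 1 - w.1)) (min (w.2 : ℕ) (s - 1 - w.2)) ∧ 2 * r + 1 < s ∧
      ((w.1 : ℕ) = r ∧ (v.1 : ℕ) = 0 ∨ (w.1 : ℕ) + r + 1 = s ∧ (v.1 : ℕ) + 1 = s ∨
        (w.1 : ℕ) ≠ r ∧ (w.1 : ℕ) + r + 1 ≠ s ∧ (v.1 : ℕ) = w.1) ∧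
      ((w.2 : ℕ) = r ∧ (v.2 : ℕ) = 0 ∨ (w.2 : ℕ) + r + 1 = s ∧ (v.2 : ℕ) + 1 = s ∨
        (w.2 : ℕ) ≠ r ∧ (w.2 : ℕ) + r + 1 ≠ s ∧ (v.2 : ℕ) = w.2) := by
  have h1 := shift_cases s v.1 r
  have h2 := shift_cases s v.2 r
  obtain ⟨c1, c2, c3⟩ := lt_of_lt_cap hv hr
  obtain ⟨e1, e2⟩ := h
  rw [← e1] at h1
  rw [← e2] at h2
  clear e1 e2 hr
  unfold OnB at hv
  rcases h1 with h1 | h1 | h1 <;> rcases h2 with h2 | h2 | h2 <;>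
    refine ⟨?_, c1, ?_, ?_⟩ <;> omega

theorem isTarget_inj {s : ℕ} {v v' w : Fin s × Fin s} {r r' : ℕ} (hv : OnB v)
    (hv' : OnB v') (hr : r < cap v) (hr' : r' < cap v') (h : IsTarget v r w)
    (h' : IsTarget v' r' w) : v = v' ∧ r = r' := by
  obtain ⟨h1, h2, h3, h4⟩ := h.spec hv hr
  obtain ⟨h1', h2', h3', h4'⟩ := h'.spec hv' hr'
  have e : r = r' := h1.trans h1'.symm
  clear h1 h1'
  exact ⟨node_ext (by omega) (by omega), e⟩

/-- Ranks below capacity satisfy `2 * r + 1 < s`, whereas the centre has depth `s / 2` with `2 * (s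
/ 2) + 1 = s`. -/
theorem not_isTarget_center {s : ℕ} {v v' w : Fin s × Fin s} {r : ℕ} (hv : OnB v)
    (hv' : Corner v') (hr : r < cap v) (hodd : s % 2 = 1) (h : IsTarget v r w)
    (h' : IsTarget v' (s / 2) w) : False := by
  obtain ⟨h1, h2, -, -⟩ := h.spec hv hr
  have h3 := shift_cases s v'.1 (s / 2)
  have h4 := shift_cases s v'.2 (s / 2)
  unfold IsTarget at h'
  unfold Corner at hv'
  omega

/-- Every node is a target, except for the centre if `s` is odd. -/
theorem exists_station {s : ℕ} (hs : 2 ≤ s) (w : Fin s × Fin s)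
    (hw : s % 2 = 0 ∨ (w.1 : ℕ) ≠ s / 2 ∨ (w.2 : ℕ) ≠ s / 2) :
    ∃ v r, OnB v ∧ r < cap v ∧ IsTarget v r w := by
  have b1 := w.1.2
  have b2 := w.2.2
  obtain ⟨r, hr⟩ : ∃ r : ℕ, r = min (min (w.1 : ℕ) (s - 1 - w.1)) (min (w.2 : ℕ) (s - 1 - w.2)) :=
    ⟨_, rfl⟩
  -- With `r` the depth of `w`, this undoes `shift`: coordinates at distance `r` from a wall go back
  -- to that wall.
  let f : ℕ → ℕ := fun x => if x = r then 0 else if x + r = s - 1 then s - 1 else x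
  have hf : ∀ x, (x = r ∧ f x = 0) ∨ (x ≠ r ∧ x + r = s - 1 ∧ f x = s - 1) ∨
      (x ≠ r ∧ x + r ≠ s - 1 ∧ f x = x) := by
    intro x
    simp only [f]
    split_ifs <;> omega
  have f1 := hf w.1
  have f2 := hf w.2
  refine ⟨(⟨f w.1, by omega⟩, ⟨f w.2, by omega⟩), r, ?_, ?_, ?_⟩
  · simp only [OnB]; omega
  · unfold cap Corner
    simp only
    split_ifs <;> omega
  · have h1 := shift_cases s (f w.1) r
    have h2 := shift_cases s (f w.2) r
    simp only [IsTarget]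
    omega

/-! ### The program -/

/-- The smallest number different from `a` and `b`. -/
def pick (a b : ℕ) : ℕ := if a ≠ 0 ∧ b ≠ 0 then 0 else if a ≠ 1 ∧ b ≠ 1 then 1 else 2

theorem pick_spec (a b : ℕ) : pick a b ≠ a ∧ pick a b ≠ b ∧ pick a b ≤ 2 := by
  unfold pick
  split_ifs <;> omega

/-- As 4 is never a port, only one port is excluded here, so the choice exists even at a corner. -/
theorem pick_four (a : ℕ) : pick a 4 ≤ 1 := by
  unfold pick
  split_ifs <;> omega

/-- Initial memory. -/
def initMem (i : ℕ) : Mem := ⟨i, 0, .out, 4, 0, 0⟩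

/-- The round in which the robots leave the stations. -/
def tourT (s : ℕ) : ℕ := 30 * s

/-- The round in which all robots have terminated. -/
def endT (s : ℕ) : ℕ := 60 * s

/-- Termination. -/
def haltMem (s : ℕ) (m : Mem) : Bool := decide (m.mode = .done ∨ endT s ≤ m.clk)

/-- A robot with memory `m` that is at a boundary node of degree `δ` has just reached it along the
boundary and knows its place in the boundary. -/
def Decider (δ : ℕ) (m : Mem) : Prop := m.mode = .fresh ∧ (1 ≤ m.pos ∨ δ = 2)

instance (δ : ℕ) (m : Mem) : Decidable (Decider δ m) := by unfold Decider; infer_instance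

/-- Distance from the last corner after one more step along the boundary. -/
def newX (δ : ℕ) (m : Mem) : ℕ := if δ = 2 then 0 else m.x + 1

/-- Number of boundary nodes visited since the first corner, after one more step. -/
def newPos (δ : ℕ) (m : Mem) : ℕ := if m.pos = 0 then (if δ = 2 then 1 else 0) else m.pos + 1

/-- The capacity of a boundary node at distance `x` from the last corner. -/
def capOf (s δ x : ℕ) : ℕ := if δ = 2 then s / 2 else min x (s - 1 - x)

/-- The robot with memory `m` is taken in at its station. -/
def Joins (s δ : ℕ) (m : Mem) (o : Multiset Mem) : Prop :=
  o.countP (fun a => a.mode = .res) + o.countP (fun a => Decider δ a ∧ a.id < m.id) <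
    capOf s δ (newX δ m)

instance (s δ : ℕ) (m : Mem) (o : Multiset Mem) : Decidable (Joins s δ m o) := by
  unfold Joins; infer_instance

/-- First part: go to the boundary and tour around it until taken in at a station. -/
def tourStep (s δ e : ℕ) (m : Mem) (o : Multiset Mem) : Mem × Option ℕ :=
  match m.mode with
  -- A robot that has not moved yet has `e = 4` and sets out through port 2. At the boundary `c`
  -- keeps the value 4: there is no boundary neighbour to avoid yet.
  | .out => if δ = 4 then (m, some ((e + 2) % 4)) else ({m with mode := .fresh}, some (pick 4 e))
  | .fresh =>
    if δ = 4 then ({m with mode := .ret}, some e)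
    else if Decider δ m ∧ Joins s δ m o then ({m with mode := .res}, none)
    -- The tour ends only at a corner, since the centre is reached from there by a walk of `s / 2`
    -- steps along a side and then inwards.
    else if 4 * (s - 1) ≤ newPos δ m ∧ δ = 2 then ({m with mode := .left}, none)
    else ({m with c := e, x := newX δ m, pos := newPos δ m}, some (pick e 4))
  | .ret => ({m with mode := .fresh}, some (pick m.c e))
  | _ => (m, none)

/-- The start of the second part, for a robot of rank `r`. -/
def launch (δ : ℕ) (m : Mem) (r : ℕ) : Mem × Option ℕ :=
  if r = 0 then ({m with mode := .done}, none)
  -- Either port of the corner will do: the diagonal target is the same from both sides. Port 0 is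
  -- `pick 4 4`.
  else if δ = 2 then ({m with mode := .ffresh, c := 4, x := r, pos := r}, some 0)
  else ({m with mode := .ftry, c := 0, pos := r}, some 0)

/-- Straight on, for `m.pos - 1` more steps. -/
def inward (e : ℕ) (m : Mem) : Mem × Option ℕ :=
  if m.pos ≤ 1 then ({m with mode := .done}, none)
  else ({m with mode := .fgo, pos := m.pos - 1}, some ((e + 2) % 4))

/-- Second part: go from the station to the target. -/
def finalStep (δ e : ℕ) (m : Mem) : Mem × Option ℕ :=
  match m.mode with
  | .ffresh =>
    if δ = 4 then ({m with mode := .fret}, some e)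
    else if m.x ≤ 1 then ({m with mode := .ftry, c := 0}, some 0)
    else ({m with c := e, x := m.x - 1}, some (pick e 4))
  | .fret => ({m with mode := .ffresh}, some (pick m.c e))
  | .ftry => if δ = 4 then inward e m else ({m with mode := .fback}, some e)
  | .fback => ({m with mode := .ftry, c := m.c + 1}, some (m.c + 1))
  | .fgo => inward e m
  | _ => (m, none)

/-- The rank of a robot when it leaves its station. -/
def launchRank (s : ℕ) (m : Mem) (o : Multiset Mem) : ℕ :=
  if m.mode = .left then s / 2
  else min (o.countP fun a => a.mode = .res ∧ a.id < m.id) (s / 2)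

/-- The choices of a robot, up to the clock. -/
def plan (s δ e : ℕ) (m : Mem) (o : Multiset Mem) : Mem × Option ℕ :=
  if m.clk < tourT s then tourStep s δ e m o
  else if m.clk = tourT s then launch δ m (launchRank s m o)
  else finalStep δ e m

/-- One round of the program. -/
def robotStep (s δ : ℕ) (inp : Option ℕ) (m : Mem) (o : Multiset Mem) : Mem × Option ℕ :=
  -- Ports are at most 3, so 4 stands for "did not move".
  let r := plan s δ (inp.getD 4) m o
  ({r.1 with clk := m.clk + 1}, r.2)

/-! ### The tour around the boundary -/

section Tour

variable {s : ℕ} (L : PortLabeling (grid s))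

/-- At time `t` the robot is at the boundary node `v`, which it has entered through port `c`
(`4` at the beginning). -/
def Based (full : Fin s × Fin s → Prop) (v : Fin s × Fin s) (c x pos t : ℕ) : Prop :=
  OnB v ∧ ((c = 4 ∧ pos = 0 ∧ x = 0 ∧ t ≤ s) ∨
    ∃ d u, OnB u ∧ (grid s).Adj v u ∧ Nxt d u v ∧ c = L.pt v u ∧
      -- Before the first corner `x` merely counts steps; being at most the offset, it bounds the
      -- time of this stage.
      ((pos = 0 ∧ ¬ Corner v ∧ x ≤ dirOff d v ∧ t ≤ s + 3 * x) ∨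
        -- A touring robot leaves a corner only with `pos < 4 * (s - 1)`, so `pos` can exceed this
        -- by at most the offset `x`.
        (1 ≤ pos ∧ x = dirOff d v ∧ pos ≤ 4 * (s - 1) + x ∧ t ≤ 4 * s + 3 * pos ∧
          ∀ w, OnB w → backDist d v w < pos → full w)))

/-- The robot has just left a boundary node, which it had entered through port `c`, looking for the
next one. -/
def Probe (base : Fin s × Fin s → ℕ → Prop) (t : ℕ) (v : Fin s × Fin s) (inp : Option ℕ)
    (c : ℕ) : Prop :=
  ∃ u t0, (grid s).Adj u v ∧ inp = some (L.pt v u) ∧ L.pt u v ≠ c ∧ base u t0 ∧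
    (¬ OnB v ∧ t ≤ t0 + 1 ∨ OnB v ∧ t ≤ t0 + 3)

/-- The robot is looking for the next boundary node during the first part. -/
def FreshInv (full : Fin s × Fin s → Prop) (t : ℕ) (v : Fin s × Fin s) (inp : Option ℕ)
    (c x pos : ℕ) : Prop :=
  Probe L (fun u t0 => Based L full u c x pos t0) t v inp c

/-- Invariant of a robot during the first part. -/
def TourInv (full : Fin s × Fin s → Prop) (t : ℕ) (r : Conf (Fin s × Fin s)) : Prop :=
  r.mem.clk = t ∧
  match r.mem.mode with
  | .out => r.mem.c = 4 ∧ r.mem.x = 0 ∧ r.mem.pos = 0 ∧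
      ((r.inp = none ∧ t = 0) ∨ ∃ u, (grid s).Adj r.node u ∧ ¬ OnB u ∧
        r.inp = some (L.pt r.node u) ∧
        (((u.1 : ℕ) + 1 = r.node.1 ∧ t ≤ r.node.1) ∨
          ((r.node.1 : ℕ) + 1 = u.1 ∧ t + r.node.1 + 1 ≤ s) ∨
          ((u.2 : ℕ) + 1 = r.node.2 ∧ t ≤ r.node.2) ∨
          ((r.node.2 : ℕ) + 1 = u.2 ∧ t + r.node.2 + 1 ≤ s)))
  | .fresh => FreshInv L full t r.node r.inp r.mem.c r.mem.x r.mem.pos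
  | .ret => ∃ w t0, (grid s).Adj r.node w ∧ ¬ OnB w ∧ r.inp = some (L.pt r.node w) ∧
      Based L full r.node r.mem.c r.mem.x r.mem.pos t0 ∧ t ≤ t0 + 2
  | .res => OnB r.node
  | .left => Corner r.node ∧ ∀ w, OnB w → full w
  | _ => False

variable {L} {full full' : Fin s × Fin s → Prop}

theorem Based.mono {v : Fin s × Fin s} {c x pos t : ℕ} (h : Based L full v c x pos t)
    (hf : ∀ w, full w → full' w) : Based L full' v c x pos t := by
  obtain ⟨h1, h2 | ⟨d, u, a1, a2, a3, a4, h3 | ⟨b1, b2, b3, b4, b5⟩⟩⟩ := h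
  · exact ⟨h1, Or.inl h2⟩
  · exact ⟨h1, Or.inr ⟨d, u, a1, a2, a3, a4, Or.inl h3⟩⟩
  · exact ⟨h1, Or.inr ⟨d, u, a1, a2, a3, a4,
      Or.inr ⟨b1, b2, b3, b4, fun w hw hd => hf w (b5 w hw hd)⟩⟩⟩

theorem Based.time_le (hs : 2 ≤ s) {v : Fin s × Fin s} {c x pos t : ℕ}
    (h : Based L full v c x pos t) : t ≤ 19 * s := by
  obtain ⟨h1, h2 | ⟨d, u, a1, a2, a3, a4, h3 | ⟨b1, b2, b3, b4, b5⟩⟩⟩ := h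
  · omega
  · have := dirOff_lt hs d h1
    omega
  · have := dirOff_lt hs d h1
    omega

/-- The first attempt to find the next boundary node. -/
theorem probe_first (hs : 2 ≤ s) {base : Fin s × Fin s → ℕ → Prop} {v : Fin s × Fin s} (c : ℕ)
    {t : ℕ} (h : base v t) :
    pick c 4 < (grid s).degree v ∧
      Probe L base (t + 1) (L.nb v (pick c 4)) (some (L.pt (L.nb v (pick c 4)) v)) c := by
  have hd : pick c 4 < (grid s).degree v := by
    have := pick_four c
    have := grid_degree_cases hs v
    omega
  have ha := L.adj_nb hd
  refine ⟨hd, v, t, ha, rfl, ?_, h, ?_⟩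
  · rw [L.pt_nb hd]
    exact (pick_spec c 4).1
  · by_cases hb : OnB (L.nb v (pick c 4))
    · exact Or.inr ⟨hb, by omega⟩
    · exact Or.inl ⟨hb, by omega⟩

/-- The second attempt, after the first one has led to the internal node `w`. -/
theorem probe_second (hs : 2 ≤ s) {base : Fin s × Fin s → ℕ → Prop} {v w : Fin s × Fin s} (c : ℕ)
    {t t' : ℕ} (h : base v t) (hv : OnB v) (hw : (grid s).Adj v w) (hw' : ¬ OnB w)
    (ht : t' ≤ t + 2) :
    pick c (L.pt v w) < (grid s).degree v ∧
      Probe L base (t' + 1) (L.nb v (pick c (L.pt v w)))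
        (some (L.pt (L.nb v (pick c (L.pt v w))) v)) c := by
  have hp := pick_spec c (L.pt v w)
  have hd : pick c (L.pt v w) < (grid s).degree v := by
    -- Having an internal neighbour, `v` has degree 3, so a third port is available.
    have hc : ¬ Corner v := fun hc => hw' (hc.onB_of_adj hw)
    have := grid_degree_cases hs v
    grind
  have ha := L.adj_nb hd
  refine ⟨hd, v, t, ha, rfl, ?_, h, Or.inr ⟨?_, by omega⟩⟩
  · rw [L.pt_nb hd]
    exact hp.1
  · by_contra hb
    have := inner_unique hv ha hw hb hw'
    have e := L.pt_nb hd
    rw [this] at e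
    exact hp.2.1 e.symm

/-- The direction of a robot that arrives at the next boundary node. -/
theorem Based.exists_nxt (hs : 2 ≤ s) {u v : Fin s × Fin s} {c x pos t : ℕ}
    (h : Based L full u c x pos t) (ha : (grid s).Adj u v) (hv : OnB v) (hc : L.pt u v ≠ c) :
    ∃ d, Nxt d u v ∧ ((pos = 0 ∧ x ≤ dirOff d u ∧ t ≤ s + 3 * x) ∨
        (1 ≤ pos ∧ x = dirOff d u ∧ pos ≤ 4 * (s - 1) + x ∧ t ≤ 4 * s + 3 * pos ∧
          ∀ w, OnB w → backDist d u w < pos → full w)) := by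
  obtain ⟨h1, h2 | ⟨d, t, a1, a2, a3, a4, h3⟩⟩ := h
  · obtain ⟨d, hd⟩ := _root_.exists_nxt hs h1 hv ha
    exact ⟨d, hd, Or.inl (by omega)⟩
  · refine ⟨d, Nxt.next hs a1 h1 hv ha a3 ?_, ?_⟩
    · rintro rfl
      exact hc a4.symm
    · rcases h3 with h3 | h3
      · exact Or.inl ⟨h3.1, h3.2.2⟩
      · exact Or.inr h3

/-- The robots at a station agree on its capacity. -/
theorem FreshInv.capOf_eq (hs : 2 ≤ s) {t : ℕ} {v : Fin s × Fin s} {inp : Option ℕ} {m : Mem}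
    (h : FreshInv L full t v inp m.c m.x m.pos) (hv : OnB v)
    (hd : Decider ((grid s).degree v) m) :
    capOf s ((grid s).degree v) (newX ((grid s).degree v) m) = cap v := by
  obtain ⟨u, t0, ha, -, hc, hb, -⟩ := h
  obtain ⟨d, hn, h3⟩ := hb.exists_nxt hs ha hv hc
  by_cases hcor : Corner v
  · have := (grid_degree_eq_two hs).2 hcor
    simp [capOf, this, cap_of_corner hcor]
  · have h2 : (grid s).degree v ≠ 2 := fun h => hcor ((grid_degree_eq_two hs).1 h)
    have hpos : 1 ≤ m.pos := by
      rcases hd.2 with h | h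
      · exact h
      · exact absurd h h2
    have hx : m.x = dirOff d u := by omega
    rw [cap_of_not_corner hs d hv hcor, hn.dirOff hs hb.1 hv hcor]
    simp [capOf, newX, h2, hx]

theorem FreshInv.arrive (hs : 2 ≤ s) {t : ℕ} {v : Fin s × Fin s} {inp : Option ℕ} {m : Mem}
    (h : FreshInv L full t v inp m.c m.x m.pos) (hv : OnB v) (hm : m.mode = .fresh)
    (hmono : ∀ w, full w → full' w)
    (hfull : Decider ((grid s).degree v) m → full' v) :
    (4 * (s - 1) ≤ newPos ((grid s).degree v) m ∧ (grid s).degree v = 2 →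
        Corner v ∧ ∀ w, OnB w → full' w) ∧
      (¬ (4 * (s - 1) ≤ newPos ((grid s).degree v) m ∧ (grid s).degree v = 2) →
        Based L full' v (inp.getD 4) (newX ((grid s).degree v) m) (newPos ((grid s).degree v) m)
          t) := by
  obtain ⟨u, t0, ha, hinp, hc, hb, ht⟩ := h
  have ht : t ≤ t0 + 3 := by rcases ht with ht | ht <;> omega
  obtain ⟨d, hn, h3⟩ := hb.exists_nxt hs ha hv hc
  have hoff := dirOff_lt hs d hb.1
  -- The window behind `v` consists of `v`, which has just turned the robot away, and the window
  -- behind `u`. A positive new count makes the robot a decider at `v`.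
  have hvis : 1 ≤ newPos ((grid s).degree v) m →
      ∀ w, OnB w → backDist d v w < newPos ((grid s).degree v) m → full' w := by
    intro hp w hw hlt
    by_cases hwv : w = v
    · rw [hwv]
      apply hfull
      refine ⟨hm, ?_⟩
      unfold newPos at hp
      split_ifs at hp with h1 h2
      · exact Or.inr h2
      · omega
      · left; omega
    · have hbd := hn.backDist hs hb.1 hv hw hwv
      rcases h3 with h3 | h3
      · unfold newPos at hlt
        split_ifs at hlt <;> omega
      · apply hmono
        apply h3.2.2.2.2 w hw
        unfold newPos at hlt
        split_ifs at hlt <;> omega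
  constructor
  · rintro ⟨h4, h2⟩
    refine ⟨(grid_degree_eq_two hs).1 h2, fun w hw => hvis (by omega) w hw ?_⟩
    exact lt_of_lt_of_le (backDist_lt hs d hv hw) h4
  · intro hnot
    refine ⟨hv, Or.inr ⟨d, u, hb.1, ha.symm, hn, by simp [hinp], ?_⟩⟩
    by_cases hcor : Corner v
    · have h2 := (grid_degree_eq_two hs).2 hcor
      have h0 := (dirOff_corner hs d hv).2 hcor
      have h1 : 1 ≤ newPos ((grid s).degree v) m := by
        unfold newPos; split_ifs <;> omega
      refine Or.inr ⟨h1, ?_, ?_, ?_, hvis h1⟩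
      · simp [newX, h2, h0]
      · omega
      · unfold newPos; split_ifs <;> omega
    · have h2 : (grid s).degree v ≠ 2 := fun h => hcor ((grid_degree_eq_two hs).1 h)
      have h0 := hn.dirOff hs hb.1 hv hcor
      have hx : newX ((grid s).degree v) m = m.x + 1 := by simp [newX, h2]
      rw [hx]
      rcases h3 with h3 | h3
      · have hp : newPos ((grid s).degree v) m = 0 := by simp [newPos, h2, h3.1]
        rw [hp]
        left
        refine ⟨rfl, hcor, ?_, ?_⟩ <;> omega
      · have hp : newPos ((grid s).degree v) m = m.pos + 1 := by
          unfold newPos; split_ifs <;> omega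
        rw [hp] at hvis ⊢
        right
        refine ⟨by omega, by omega, by omega, by omega, hvis (by omega)⟩

theorem applyMove_some {p : ℕ} {v : Fin s × Fin s} (h : p < (grid s).degree v) (m : Mem) :
    applyMove L v (m, some p) = ⟨L.nb v p, some (L.pt (L.nb v p) v), m⟩ := by
  simp [applyMove, h]

theorem applyMove_none (v : Fin s × Fin s) (m : Mem) :
    applyMove L v (m, none) = ⟨v, none, m⟩ := rfl

/-- The invariant of the first part is preserved. -/
theorem TourInv.step (hs : 2 ≤ s) (hL : L.Oriented) {t : ℕ} {r : Conf (Fin s × Fin s)}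
    (h : TourInv L full t r) (ht : t < tourT s) (hmono : ∀ w, full w → full' w)
    {o : Multiset Mem} (hfail : OnB r.node → Decider ((grid s).degree r.node) r.mem →
      ¬ Joins s ((grid s).degree r.node) r.mem o → full' r.node) :
    TourInv L full' (t + 1)
      (applyMove L r.node (robotStep s ((grid s).degree r.node) r.inp r.mem o)) := by
  obtain ⟨v, inp, m⟩ := r
  obtain ⟨hclk, h⟩ := h
  simp only at hclk h hfail ⊢
  have hplan : robotStep s ((grid s).degree v) inp m o =
      ({(tourStep s ((grid s).degree v) (inp.getD 4) m o).1 with clk := t + 1},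
        (tourStep s ((grid s).degree v) (inp.getD 4) m o).2) := by
    simp [robotStep, plan, hclk, ht]
  rw [hplan]
  unfold tourStep
  have hv1 := v.1.2
  have hv2 := v.2.2
  cases hm : m.mode <;> simp only [hm] at h ⊢
  case out =>
    obtain ⟨hc, hx, hp, h⟩ := h
    by_cases h4 : (grid s).degree v = 4
    · rw [if_pos h4]
      have hvb : ¬ OnB v := (grid_degree_eq_four hs).1 h4
      rcases h with ⟨h1, h2⟩ | ⟨u, h1, h2, h3, h5⟩
      · have hlt : (inp.getD 4 + 2) % 4 < (grid s).degree v := by rw [h4]; omega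
        have ha := grid_adj_coord (L.adj_nb hlt)
        rw [applyMove_some hlt]
        refine ⟨rfl, ?_⟩
        simp only [hm]
        refine ⟨hc, hx, hp, Or.inr ⟨v, (L.adj_nb hlt).symm, hvb, rfl, ?_⟩⟩
        unfold OnB at hvb
        omega
      · obtain ⟨hlt, hst⟩ := hL.straight_nb h4 h1
        simp only [h3, Option.getD_some]
        rw [applyMove_some hlt]
        refine ⟨rfl, ?_⟩
        simp only [hm]
        refine ⟨hc, hx, hp, Or.inr ⟨v, (L.adj_nb hlt).symm, hvb, rfl, ?_⟩⟩
        have := grid_adj_coord h1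
        unfold Straight at hst
        unfold OnB at hvb
        omega
    · rw [if_neg h4]
      have hvb : OnB v := by
        by_contra hb
        exact h4 ((grid_degree_eq_four hs).2 hb)
      rcases h with ⟨h1, h2⟩ | ⟨u, h1, h2, h3, h5⟩
      · have hb : Based L full' v 4 0 0 t := ⟨hvb, Or.inl ⟨rfl, rfl, rfl, by omega⟩⟩
        obtain ⟨b1, b2⟩ := probe_first (L := L) hs
          (base := fun u t0 => Based L full' u 4 0 0 t0) 4 hb
        simp only [h1, Option.getD_none]
        rw [applyMove_some b1]
        refine ⟨rfl, ?_⟩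
        simp only [hc, hx, hp]
        exact b2
      · have hb : Based L full' v 4 0 0 t := ⟨hvb, Or.inl ⟨rfl, rfl, rfl, by omega⟩⟩
        obtain ⟨b1, b2⟩ := probe_second (L := L) hs
          (base := fun u t0 => Based L full' u 4 0 0 t0) 4 hb hvb h1 h2 (t' := t) (by omega)
        simp only [h3, Option.getD_some]
        rw [applyMove_some b1]
        refine ⟨rfl, ?_⟩
        simp only [hc, hx, hp]
        exact b2
  case fresh =>
    by_cases h4 : (grid s).degree v = 4
    · rw [if_pos h4]
      have hvb : ¬ OnB v := (grid_degree_eq_four hs).1 h4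
      obtain ⟨u, t0, ha, hinp, hc, hb, ht0⟩ := h
      have ht1 : t ≤ t0 + 1 := by
        rcases ht0 with h | h
        · exact h.2
        · exact absurd h.1 hvb
      have hlt := L.pt_lt ha.symm
      have hnb := L.nb_pt ha.symm
      simp only [hinp, Option.getD_some]
      rw [applyMove_some hlt, hnb]
      exact ⟨rfl, v, t0, ha, hvb, rfl, hb.mono hmono, by omega⟩
    · rw [if_neg h4]
      have hvb : OnB v := by
        by_contra hb
        exact h4 ((grid_degree_eq_four hs).2 hb)
      by_cases hj : Decider ((grid s).degree v) m ∧ Joins s ((grid s).degree v) m o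
      · rw [if_pos hj]
        exact ⟨rfl, hvb⟩
      · rw [if_neg hj]
        obtain ⟨h1, h2⟩ := FreshInv.arrive hs h hvb hm hmono
          (fun hd => hfail hvb hd fun hj' => hj ⟨hd, hj'⟩)
        split_ifs with hl
        · exact ⟨rfl, h1 hl⟩
        · obtain ⟨b1, b2⟩ := probe_first (L := L) hs (base := fun u t0 => Based L full' u
            (inp.getD 4) (newX ((grid s).degree v) m) (newPos ((grid s).degree v) m) t0) _ (h2 hl)
          rw [applyMove_some b1]
          exact ⟨rfl, b2⟩
  case ret =>
    obtain ⟨w, t0, ha, hw, hinp, hb, ht0⟩ := h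
    obtain ⟨b1, b2⟩ := probe_second (L := L) hs (base := fun u t0 => Based L full' u
      m.c m.x m.pos t0) m.c (hb.mono hmono) hb.1 ha hw ht0
    simp only [hinp, Option.getD_some]
    rw [applyMove_some b1]
    exact ⟨rfl, b2⟩
  case res =>
    exact ⟨rfl, h⟩
  case left =>
    exact ⟨rfl, h.1, fun w hw => hmono w (h.2 w hw)⟩

/-- At the end of the first part all robots wait at a station. -/
theorem TourInv.settled (hs : 2 ≤ s) {r : Conf (Fin s × Fin s)}
    (h : TourInv L full (tourT s) r) :
    (r.mem.mode = .res ∧ OnB r.node) ∨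
      (r.mem.mode = .left ∧ Corner r.node ∧ ∀ w, OnB w → full w) := by
  obtain ⟨v, inp, m⟩ := r
  obtain ⟨hclk, h⟩ := h
  have hv1 := v.1.2
  have hv2 := v.2.2
  simp only at hclk h ⊢
  -- The way out takes at most `s` rounds. The last base is reached by round `19 * s`, and a probe
  -- adds at most three rounds, so round `30 * s` is too late for both.
  unfold tourT at h
  cases hm : m.mode <;> simp only [hm] at h ⊢
  case out =>
    obtain ⟨hc, hx, hp, h | ⟨u, h1, h2, h3, h5⟩⟩ := h <;> omega
  case fresh =>
    obtain ⟨u, t0, ha, hinp, hc, hb, ht0⟩ := h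
    have := hb.time_le hs
    omega
  case ret =>
    obtain ⟨w, t0, ha, hw, hinp, hb, ht0⟩ := h
    have := hb.time_le hs
    omega
  case res => exact Or.inl ⟨trivial, h⟩
  case left => exact Or.inr ⟨trivial, h⟩

end Tour

/-! ### From the stations to the targets -/

section Final

variable {s : ℕ} (L : PortLabeling (grid s))

/-- `v` is at distance `a ≥ 1` from the corner `w` on a side of the grid, and `u` is the previous
node on the way from `w` to `v`. -/
def OnSide (w u v : Fin s × Fin s) (a : ℕ) : Prop :=
  1 ≤ a ∧
  (((v.1 : ℕ) = w.1 ∧ (u.1 : ℕ) = w.1 ∧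
      (((v.2 : ℕ) = w.2 + a ∧ (u.2 : ℕ) + 1 = v.2) ∨
        ((v.2 : ℕ) + a = w.2 ∧ (v.2 : ℕ) + 1 = u.2))) ∨
    ((v.2 : ℕ) = w.2 ∧ (u.2 : ℕ) = w.2 ∧
      (((v.1 : ℕ) = w.1 + a ∧ (u.1 : ℕ) + 1 = v.1) ∨
        ((v.1 : ℕ) + a = w.1 ∧ (v.1 : ℕ) + 1 = u.1))))

theorem onSide_one {w v : Fin s × Fin s} (ha : (grid s).Adj w v) : OnSide w w v 1 := by
  have := grid_adj_coord ha
  unfold OnSide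
  omega

/-- As `a + 1 < s`, the far corner is not yet reached at `v`, so the only boundary neighbour other
than `u` continues the side. -/
theorem OnSide.next {w u v v' : Fin s × Fin s} {a : ℕ} (hw : Corner w) (h : OnSide w u v a)
    (ha : a + 1 < s) (hv : (grid s).Adj v v') (hv' : OnB v') (hne : v' ≠ u) :
    OnSide w v v' (a + 1) := by
  have h1 := grid_adj_coord hv
  have h2 := node_ne hne
  have := v'.1.2
  have := v'.2.2
  have := v.1.2
  have := v.2.2
  unfold OnSide at *
  unfold Corner at hw
  unfold OnB at hv'
  obtain ⟨h0, h⟩ := h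
  rcases h with ⟨b1, b2, b3 | b3⟩ | ⟨b1, b2, b3 | b3⟩ <;>
    rcases h1 with ⟨c1 | c1, c2⟩ | ⟨c1 | c1, c2⟩ <;> omega

/-- During the walk along the boundary the robot is at the boundary node `v`; it is `x` steps
before the end of this walk. -/
def FBased (τ v : Fin s × Fin s) (c x pos t : ℕ) : Prop :=
  ∃ w, Corner w ∧ IsTarget w pos τ ∧ OnB v ∧ 1 ≤ x ∧ x ≤ pos ∧ 2 * pos < s ∧
    t + 3 * x ≤ tourT s + 3 * pos ∧
    ((c = 4 ∧ v = w ∧ x = pos) ∨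
      ∃ u, (grid s).Adj v u ∧ c = L.pt v u ∧ x < pos ∧ OnSide w u v (pos - x))

/-- The data of a robot that looks for the inward port of the boundary node `u`, and has tried
the ports smaller than `c`. -/
def Seek (τ u : Fin s × Fin s) (c pos : ℕ) : Prop :=
  OnB u ∧ ¬ Corner u ∧ IsTarget u pos τ ∧ 1 ≤ pos ∧ 2 * pos < s ∧
    ∀ w, (grid s).Adj u w → ¬ OnB w → c ≤ L.pt u w

/-- The robot enters `v` on a straight way to `τ`, which is `pos - 1` steps ahead. -/
def GoInv (τ : Fin s × Fin s) (t : ℕ) (v : Fin s × Fin s) (inp : Option ℕ) (pos : ℕ) : Prop :=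
  ∃ u, (grid s).Adj v u ∧ inp = some (L.pt v u) ∧ ¬ OnB v ∧ ¬ OnB τ ∧ 1 ≤ pos ∧
    t + pos ≤ 40 * s ∧
    (((u.1 : ℕ) = v.1 ∧ (τ.1 : ℕ) = v.1 ∧
        (((u.2 : ℕ) + 1 = v.2 ∧ (τ.2 : ℕ) + 1 = v.2 + pos) ∨
          ((v.2 : ℕ) + 1 = u.2 ∧ (τ.2 : ℕ) + pos = v.2 + 1))) ∨
      ((u.2 : ℕ) = v.2 ∧ (τ.2 : ℕ) = v.2 ∧
        (((u.1 : ℕ) + 1 = v.1 ∧ (τ.1 : ℕ) + 1 = v.1 + pos) ∨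
          ((v.1 : ℕ) + 1 = u.1 ∧ (τ.1 : ℕ) + pos = v.1 + 1))))

/-- Invariant of a robot with target `τ` during the second part. -/
def FinalInv (τ : Fin s × Fin s) (t : ℕ) (r : Conf (Fin s × Fin s)) : Prop :=
  match r.mem.mode with
  | .ffresh => r.mem.clk = t ∧
      Probe L (fun u t0 => FBased L τ u r.mem.c r.mem.x r.mem.pos t0) t r.node r.inp r.mem.c
  | .fret => r.mem.clk = t ∧ ∃ w t0, (grid s).Adj r.node w ∧ ¬ OnB w ∧
      r.inp = some (L.pt r.node w) ∧ FBased L τ r.node r.mem.c r.mem.x r.mem.pos t0 ∧ t ≤ t0 + 2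
  | .ftry => r.mem.clk = t ∧ ∃ u, Seek L τ u r.mem.c r.mem.pos ∧ (grid s).Adj u r.node ∧
      r.inp = some (L.pt r.node u) ∧ L.pt u r.node = r.mem.c ∧
      t ≤ tourT s + 3 * r.mem.pos + 2 * r.mem.c + 1
  | .fback => r.mem.clk = t ∧ Seek L τ r.node (r.mem.c + 1) r.mem.pos ∧
      t ≤ tourT s + 3 * r.mem.pos + 2 * r.mem.c + 2
  | .fgo => r.mem.clk = t ∧ GoInv L τ t r.node r.inp r.mem.pos
  | .done => r.node = τ
  | _ => False

variable {L} {τ : Fin s × Fin s}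

theorem exists_inner (hs : 2 ≤ s) {u : Fin s × Fin s} (hu : OnB u) (hc : ¬ Corner u) :
    ∃ w, (grid s).Adj u w ∧ ¬ OnB w := by
  obtain ⟨⟨x, hx⟩, ⟨y, hy⟩⟩ := u
  simp only [OnB, Corner] at hu hc
  by_cases h1 : x = 0
  · refine ⟨(⟨1, by omega⟩, ⟨y, hy⟩), ?_, ?_⟩
    · rw [grid_adj]; exact Or.inl ⟨by simp only; omega, rfl⟩
    · simp only [OnB]; omega
  by_cases h2 : x + 1 = s
  · refine ⟨(⟨x - 1, by omega⟩, ⟨y, hy⟩), ?_, ?_⟩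
    · rw [grid_adj]; exact Or.inl ⟨by simp only; omega, rfl⟩
    · simp only [OnB]; omega
  by_cases h3 : y = 0
  · refine ⟨(⟨x, hx⟩, ⟨1, by omega⟩), ?_, ?_⟩
    · rw [grid_adj]; exact Or.inr ⟨by simp only; omega, rfl⟩
    · simp only [OnB]; omega
  · refine ⟨(⟨x, hx⟩, ⟨y - 1, by omega⟩), ?_, ?_⟩
    · rw [grid_adj]; exact Or.inr ⟨by simp only; omega, rfl⟩
    · simp only [OnB]; omega

theorem FBased.onB {v : Fin s × Fin s} {c x pos t : ℕ} (h : FBased L τ v c x pos t) : OnB v := by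
  obtain ⟨w, -, -, h, -⟩ := h
  exact h

/-- Trying the port `c`. -/
theorem Seek.attempt (hs : 2 ≤ s) {u : Fin s × Fin s} {c pos t : ℕ} (h : Seek L τ u c pos)
    (m : Mem) (ht : t ≤ tourT s + 3 * pos + 2 * c) (hm : m.mode = .ftry) (hmc : m.c = c)
    (hmp : m.pos = pos) (hmk : m.clk = t + 1) :
    FinalInv L τ (t + 1) (applyMove L u (m, some c)) := by
  obtain ⟨w, hw, hw'⟩ := exists_inner hs h.1 h.2.1
  -- The inward port has not been tried yet, so port `c` exists.
  have hlt : c < (grid s).degree u := lt_of_le_of_lt (h.2.2.2.2.2 w hw hw') (L.pt_lt hw)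
  rw [applyMove_some hlt]
  simp only [FinalInv, hm, hmk, hmc, hmp]
  exact ⟨trivial, u, h, L.adj_nb hlt, rfl, L.pt_nb hlt, by omega⟩

theorem GoInv.inward (hs : 2 ≤ s) (hL : L.Oriented) {t pos : ℕ} {v : Fin s × Fin s}
    {inp : Option ℕ} {m : Mem} (h : GoInv L τ t v inp pos) (hmp : m.pos = pos) :
    FinalInv L τ (t + 1) (applyMove L v
      ({(inward (inp.getD 4) m).1 with clk := t + 1}, (inward (inp.getD 4) m).2)) := by
  obtain ⟨u, h1, h2, h3, h4, h5, h6, h7⟩ := h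
  unfold _root_.inward
  split_ifs with hp
  · simp only [applyMove_none, FinalInv]
    apply node_ext <;> omega
  · have hdeg := (grid_degree_eq_four hs).2 h3
    obtain ⟨hlt, hst⟩ := hL.straight_nb hdeg h1
    simp only [h2, Option.getD_some]
    rw [applyMove_some hlt]
    simp only [FinalInv]
    unfold Straight at hst
    refine ⟨trivial, v, (L.adj_nb hlt).symm, rfl, ?_, h4, by omega, by omega, ?_⟩
    · unfold OnB at *
      omega
    · omega

/-- Exactly one coordinate of `u` is at a wall, so its target lies on the inward line through `v`;
`1 ≤ pos` and `2 * pos < s` keep the target off the boundary. -/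
theorem Seek.goInv {u v : Fin s × Fin s} {c pos t : ℕ} (h : Seek L τ u c pos)
    (ha : (grid s).Adj u v) (hv : ¬ OnB v) (ht : t + pos ≤ 40 * s) :
    GoInv L τ t v (some (L.pt v u)) pos := by
  obtain ⟨h1, h2, ⟨h3, h4⟩, h5, h6, -⟩ := h
  have e1 := shift_cases s u.1 pos
  have e2 := shift_cases s u.2 pos
  have hadj := grid_adj_coord ha
  have := u.1.2
  have := u.2.2
  unfold OnB at h1
  unfold Corner at h2
  refine ⟨u, ha.symm, rfl, hv, ?_, h5, ht, ?_⟩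
  · unfold OnB
    clear hadj hv
    rcases e1 with e1 | e1 | e1 <;> rcases e2 with e2 | e2 | e2 <;> omega
  · unfold OnB at hv
    rcases hadj with ⟨c1 | c1, c2⟩ | ⟨c1 | c1, c2⟩ <;>
      rcases e1 with e1 | e1 | e1 <;> rcases e2 with e2 | e2 | e2 <;> omega

/-- After `pos` steps along either side from the corner, the perpendicular at `v` meets the diagonal
at depth `pos`. So the corner's target is also the target of rank `pos` at `v`. -/
theorem FBased.arrive {u v : Fin s × Fin s} {c x pos t t' : ℕ} (h : FBased L τ u c x pos t)
    (ha : (grid s).Adj u v) (hv : OnB v) (hc : L.pt u v ≠ c) (ht : t' ≤ t + 3) :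
    (x ≤ 1 → Seek L τ v 0 pos ∧ t' ≤ tourT s + 3 * pos) ∧
      (¬ x ≤ 1 → FBased L τ v (L.pt v u) (x - 1) pos t') := by
  obtain ⟨w, hw, htar, hu, hx1, hxp, hps, hto, h⟩ := h
  have hside : OnSide w u v (pos - (x - 1)) := by
    rcases h with ⟨-, rfl, rfl⟩ | ⟨z, hz, hcz, hxlt, hside⟩
    · have := onSide_one ha
      rwa [show x - (x - 1) = 1 by omega]
    · have := hside.next hw (by omega) ha hv (fun e => hc (by rw [hcz, e]))
      rwa [show pos - (x - 1) = pos - x + 1 by omega]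
  clear h
  constructor
  · intro hx
    have : pos - (x - 1) = pos := by omega
    rw [this] at hside
    have hv1 := v.1.2
    have hv2 := v.2.2
    have hw1 := w.1.2
    have hw2 := w.2.2
    refine ⟨⟨hv, ?_, ?_, by omega, hps, fun _ _ _ => Nat.zero_le _⟩, by omega⟩
    · unfold OnSide Corner at *
      omega
    · have e1 := shift_cases s w.1 pos
      have e2 := shift_cases s w.2 pos
      have e3 := shift_cases s v.1 pos
      have e4 := shift_cases s v.2 pos
      obtain ⟨k1, k2⟩ := htar
      unfold OnSide at hside
      unfold Corner at hw
      obtain ⟨-, hside⟩ := hside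
      rcases hside with ⟨b1, b2, b3 | b3⟩ | ⟨b1, b2, b3 | b3⟩ <;> constructor <;> omega
  · intro hx
    exact ⟨w, hw, htar, hv, by omega, by omega, hps, by omega,
      Or.inr ⟨u, ha.symm, rfl, by omega, hside⟩⟩

theorem FinalInv.clk_eq {t : ℕ} {r : Conf (Fin s × Fin s)}
    (h : FinalInv L τ t r) (hd : r.mem.mode ≠ .done) : r.mem.clk = t := by
  unfold FinalInv at h
  cases hm : r.mem.mode <;> simp only [hm] at h hd <;> first | exact h.1 | exact absurd rfl hd

/-- The invariant of the second part is preserved. -/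
theorem FinalInv.step (hs : 2 ≤ s) (hL : L.Oriented) {t : ℕ} {r : Conf (Fin s × Fin s)}
    (h : FinalInv L τ t r) (ht : tourT s < t) (hd : r.mem.mode ≠ .done) (o : Multiset Mem) :
    FinalInv L τ (t + 1)
      (applyMove L r.node (robotStep s ((grid s).degree r.node) r.inp r.mem o)) := by
  have hclk := h.clk_eq hd
  obtain ⟨v, inp, m⟩ := r
  simp only at hclk hd ⊢
  have hplan : robotStep s ((grid s).degree v) inp m o =
      ({(finalStep ((grid s).degree v) (inp.getD 4) m).1 with clk := t + 1},
        (finalStep ((grid s).degree v) (inp.getD 4) m).2) := by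
    have h1 : ¬ t < tourT s := by omega
    have h2 : t ≠ tourT s := by omega
    simp [robotStep, plan, hclk, h1, h2]
  rw [hplan]
  unfold finalStep
  unfold FinalInv at h
  have hdeg := @grid_degree_eq_four s hs v
  cases hm : m.mode <;> simp only [hm] at h hd ⊢
  case ffresh =>
    obtain ⟨-, u, t0, ha, hinp, hc, hb, ht0⟩ := h
    by_cases h4 : (grid s).degree v = 4
    · rw [if_pos h4]
      have hvb := hdeg.1 h4
      have ht1 : t ≤ t0 + 1 := by
        rcases ht0 with h | h
        · exact h.2
        · exact absurd h.1 hvb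
      have hlt := L.pt_lt ha.symm
      have hnb := L.nb_pt ha.symm
      simp only [hinp, Option.getD_some]
      rw [applyMove_some hlt, hnb]
      exact ⟨rfl, v, t0, ha, hvb, rfl, hb, by omega⟩
    · rw [if_neg h4]
      have hvb : OnB v := by
        by_contra hb
        exact h4 (hdeg.2 hb)
      obtain ⟨h1, h2⟩ := hb.arrive ha hvb hc (t' := t) (by rcases ht0 with h | h <;> omega)
      split_ifs with hx
      · obtain ⟨h1, h1'⟩ := h1 hx
        exact h1.attempt hs _ (by omega) rfl rfl rfl rfl
      · simp only [hinp, Option.getD_some]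
        obtain ⟨b1, b2⟩ := probe_first (L := L) hs (base := fun u' t0 => FBased L τ u'
            (L.pt v u) (m.x - 1) m.pos t0) (L.pt v u) (h2 hx)
        rw [applyMove_some b1]
        exact ⟨rfl, b2⟩
  case fret =>
    obtain ⟨-, w, t0, ha, hw, hinp, hb, ht0⟩ := h
    obtain ⟨b1, b2⟩ := probe_second (L := L) hs (base := fun u t0 => FBased L τ u
      m.c m.x m.pos t0) m.c hb hb.onB ha hw ht0
    simp only [hinp, Option.getD_some]
    rw [applyMove_some b1]
    exact ⟨rfl, b2⟩
  case ftry =>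
    obtain ⟨-, u, hk, ha, hinp, hc, ht0⟩ := h
    by_cases h4 : (grid s).degree v = 4
    · rw [if_pos h4]
      have hg : GoInv L τ t v inp m.pos := by
        rw [hinp]
        have hlt := L.pt_lt ha
        have := grid_degree_cases hs u
        have := hk.2.2.2.2.1
        have : m.c ≤ 2 := by
          have := hk.1
          grind
        refine hk.goInv ha (hdeg.1 h4) ?_
        -- With `c ≤ 2` and `2 * pos < s`, the search ends soon enough to leave `pos` rounds before
        -- `40 * s`.
        unfold tourT at ht0
        omega
      exact hg.inward hs hL rfl
    · rw [if_neg h4]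
      have hvb : OnB v := by
        by_contra hb
        exact h4 (hdeg.2 hb)
      have hlt := L.pt_lt ha.symm
      have hnb := L.nb_pt ha.symm
      simp only [hinp, Option.getD_some]
      rw [applyMove_some hlt, hnb]
      obtain ⟨k1, k2, k3, k4, k5, k6⟩ := hk
      refine ⟨rfl, ⟨k1, k2, k3, k4, k5, ?_⟩, ?_⟩
      · intro w hw hw'
        have := k6 w hw hw'
        -- Port `c` led to a boundary node, so the inward port is a later one.
        have : L.pt u w ≠ m.c := by
          intro e
          rw [← hc] at e
          rw [L.pt_inj hw ha e] at hw'
          exact hw' hvb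
        simp only
        omega
      · simp only
        omega
  case fback =>
    obtain ⟨-, hk, ht0⟩ := h
    exact hk.attempt hs _ (by omega) rfl rfl rfl rfl
  case fgo => exact h.2.inward hs hL rfl
  case done => exact absurd rfl hd

/-- In the end the robots have reached their targets. -/
theorem FinalInv.eq_done (hs : 2 ≤ s) {t : ℕ} {r : Conf (Fin s × Fin s)}
    (h : FinalInv L τ t r) (ht : 50 * s ≤ t) : r.mem.mode = .done := by
  unfold FinalInv tourT at h
  cases hm : r.mem.mode <;> simp only [hm] at h ⊢
  case ffresh =>
    obtain ⟨-, u, t0, ha, hinp, hc, hb, ht0⟩ := h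
    obtain ⟨w, -, -, -, h1, h2, h3, h4, -⟩ := hb
    unfold tourT at h4
    omega
  case fret =>
    obtain ⟨-, u, t0, ha, hinp, hc, hb, ht0⟩ := h
    obtain ⟨w, -, -, -, h1, h2, h3, h4, -⟩ := hb
    unfold tourT at h4
    omega
  case ftry =>
    obtain ⟨-, u, hk, ha, hinp, hc, ht0⟩ := h
    have := hk.2.2.2.2.1
    have := L.pt_lt ha
    have := grid_degree_cases hs u
    omega
  case fback =>
    obtain ⟨-, hk, ht0⟩ := h
    have := hk.2.2.2.2.1
    obtain ⟨w, hw, hw'⟩ := exists_inner hs hk.1 hk.2.1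
    have := hk.2.2.2.2.2 w hw hw'
    have := L.pt_lt hw
    have := grid_degree_cases hs r.node
    omega
  case fgo =>
    obtain ⟨-, u, h1, h2, h3, h4, h5, h6, -⟩ := h
    omega

/-- Leaving a station. -/
theorem launch_finalInv (hs : 2 ≤ s) {v : Fin s × Fin s} {m : Mem} {r : ℕ} (hv : OnB v)
    (htar : IsTarget v r τ) (hr : 2 * r < s) :
    FinalInv L τ (tourT s + 1) (applyMove L v
      ({(launch ((grid s).degree v) m r).1 with clk := tourT s + 1},
        (launch ((grid s).degree v) m r).2)) := by
  unfold launch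
  split_ifs with h0 h2
  · have e1 := shift_cases s v.1 r
    have e2 := shift_cases s v.2 r
    obtain ⟨k1, k2⟩ := htar
    simp only [applyMove_none, FinalInv]
    apply node_ext <;> omega
  · have hc := (grid_degree_eq_two hs).1 h2
    have hb : FBased L τ v 4 r r (tourT s) :=
      ⟨v, hc, htar, hv, by omega, le_refl _, hr, le_refl _, Or.inl ⟨rfl, rfl, rfl⟩⟩
    obtain ⟨b1, b2⟩ := probe_first (L := L) hs (base := fun u t0 => FBased L τ u 4 r r t0) 4 hb
    have hp : pick 4 4 = 0 := rfl
    rw [hp] at b1 b2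
    rw [applyMove_some b1]
    exact ⟨rfl, b2⟩
  · have hc : ¬ Corner v := fun h => h2 ((grid_degree_eq_two hs).2 h)
    have hk : Seek L τ v 0 r := ⟨hv, hc, htar, by omega, hr, fun _ _ _ => Nat.zero_le _⟩
    exact hk.attempt hs _ (by omega) rfl rfl rfl rfl

end Final

/-! ### Filling the stations -/

/-- Ranks in a finite set. -/
theorem card_filter_rank_lt {ι : Type*} [DecidableEq ι] (D : Finset ι) (f : ι → ℕ)
    (hf : Function.Injective f) (q : ℕ) :
    (D.filter fun d => (D.filter fun j => f j < f d).card < q).card = min q D.card := by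
  have hlt : ∀ d ∈ D, (D.filter fun j => f j < f d).card < D.card := by
    intro d hd
    apply Finset.card_lt_card
    refine ⟨Finset.filter_subset _ _, fun h => ?_⟩
    have := (Finset.mem_filter.1 (h hd)).2
    omega
  have hinj : Set.InjOn (fun d => (D.filter fun j => f j < f d).card) D := by
    have aux : ∀ a ∈ D, ∀ b ∈ D, f a < f b →
        (D.filter fun j => f j < f a).card < (D.filter fun j => f j < f b).card := by
      intro a ha b hb hab
      apply Finset.card_lt_card
      refine ⟨fun j hj => ?_, fun h => ?_⟩
      · rw [Finset.mem_filter] at hj ⊢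
        exact ⟨hj.1, by omega⟩
      · have := (Finset.mem_filter.1 (h (Finset.mem_filter.2 ⟨ha, hab⟩))).2
        omega
    intro a ha b hb hab
    simp only at hab
    rcases lt_trichotomy (f a) (f b) with h | h | h
    · have := aux a ha b hb h; omega
    · exact hf h
    · have := aux b hb a ha h; omega
  -- Ranks are distinct and below `D.card`, so they are exactly the numbers `0, …, D.card - 1`.
  have himg : D.image (fun d => (D.filter fun j => f j < f d).card) = Finset.range D.card := by
    apply Finset.eq_of_subset_of_card_le
    · intro x hx
      obtain ⟨d, hd, rfl⟩ := Finset.mem_image.1 hx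
      exact Finset.mem_range.2 (hlt d hd)
    · rw [Finset.card_image_of_injOn hinj, Finset.card_range]
  rw [← Finset.card_image_of_injOn (hinj.mono (Finset.filter_subset _ _))]
  have : (D.filter fun d => (D.filter fun j => f j < f d).card < q).image
      (fun d => (D.filter fun j => f j < f d).card) = Finset.range (min q D.card) := by
    ext x
    simp only [Finset.mem_image, Finset.mem_filter, Finset.mem_range, lt_min_iff]
    constructor
    · rintro ⟨d, ⟨hd, hq⟩, rfl⟩
      exact ⟨hq, hlt d hd⟩
    · rintro ⟨hq, hD⟩
      rw [← Finset.mem_range, ← himg, Finset.mem_image] at hD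
      obtain ⟨d, hd, rfl⟩ := hD
      exact ⟨d, ⟨hd, hq⟩, rfl⟩
  rw [this, Finset.card_range]

theorem applyMove_mem {V : Type*} {G : SimpleGraph V} [G.LocallyFinite] (L : PortLabeling G)
    (v : V) (r : Mem × Option ℕ) : (applyMove L v r).mem = r.1 := by
  unfold applyMove
  split
  · rfl
  · split <;> rfl

theorem robotStep_id (s δ : ℕ) (inp : Option ℕ) (m : Mem) (o : Multiset Mem) :
    (robotStep s δ inp m o).1.id = m.id := by
  simp only [robotStep, plan]
  split_ifs
  · unfold tourStep
    split <;> (try split_ifs) <;> rfl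
  · unfold launch
    split_ifs <;> rfl
  · unfold finalStep inward
    split <;> (try split_ifs) <;> rfl

theorem tourStep_mode_res {s δ e : ℕ} {m : Mem} {o : Multiset Mem} :
    (tourStep s δ e m o).1.mode = .res ↔
      m.mode = .res ∨ (δ ≠ 4 ∧ Decider δ m ∧ Joins s δ m o) := by
  unfold tourStep
  cases hm : m.mode <;> simp only [hm] <;> (try split_ifs) <;> simp_all [Decider]

theorem tourStep_stay {s δ e : ℕ} {m : Mem} {o : Multiset Mem}
    (h : (tourStep s δ e m o).1.mode = .res) : (tourStep s δ e m o).2 = none := by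
  unfold tourStep at *
  cases hm : m.mode <;> simp only [hm] at h ⊢ <;> (try split_ifs at h ⊢) <;> simp_all

theorem Alive.pred {k : ℕ} {crash : Fin k → ℕ∞} {t : ℕ} {i : Fin k}
    (h : Alive crash (t + 1) i) : Alive crash t i := by
  unfold Alive at *
  refine lt_of_le_of_lt ?_ h
  exact_mod_cast Nat.le_succ t

theorem countP_others {V : Type*} {k : ℕ} (crash : Fin k → ℕ∞) (t : ℕ) (σ : Fin k → Conf V)
    (i : Fin k) (p : Mem → Prop) [DecidablePred p] (F : Finset (Fin k))
    (hF : ∀ j, j ∈ F ↔ (j ≠ i ∧ Alive crash t j ∧ (σ j).node = (σ i).node) ∧ p (σ j).mem) :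
    (others crash t σ i).countP p = F.card := by
  classical
  unfold others
  rw [Multiset.countP_map]
  have : F = (Finset.univ.filter fun j => j ≠ i ∧ Alive crash t j ∧
      (σ j).node = (σ i).node).filter fun j => p (σ j).mem := by
    ext j
    rw [hF]
    simp
  rw [this]
  rfl

/-! ### Living residents, residents ever taken in, and full stations -/

section Global

variable {s k : ℕ}

open Classical in
/-- The robots taken in at the station `v`, crashed ones included. -/
noncomputable def resAt (σ : Fin k → Conf (Fin s × Fin s)) (v : Fin s × Fin s) :
    Finset (Fin k) :=
  Finset.univ.filter fun i => (σ i).mem.mode = .res ∧ (σ i).node = v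

open Classical in
/-- The robots at the station `v` that have been taken in there and have not crashed. -/
noncomputable def aliveResAt (crash : Fin k → ℕ∞) (t : ℕ) (σ : Fin k → Conf (Fin s × Fin s))
    (v : Fin s × Fin s) : Finset (Fin k) :=
  Finset.univ.filter fun i => Alive crash t i ∧ (σ i).mem.mode = .res ∧ (σ i).node = v

/-- The station `v` has been full. -/
def Full (σ : Fin k → Conf (Fin s × Fin s)) (v : Fin s × Fin s) : Prop :=
  cap v ≤ (resAt σ v).card

/-- Invariant of the whole configuration during the first part. -/
structure TourGlobal (L : PortLabeling (grid s)) (ident : Fin k → ℕ) (crash : Fin k → ℕ∞) (t : ℕ)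
    (σ : Fin k → Conf (Fin s × Fin s)) : Prop where
  id_eq : ∀ i, (σ i).mem.id = ident i
  tour : ∀ i, Alive crash t i → TourInv L (Full σ) t (σ i)
  card_le : ∀ v, OnB v → (aliveResAt crash t σ v).card ≤ cap v

variable {L : PortLabeling (grid s)} {ident : Fin k → ℕ} {start : Fin k → Fin s × Fin s}
  {crash : Fin k → ℕ∞} {σ : ℕ → Fin k → Conf (Fin s × Fin s)}

theorem TourInv.not_halt (hs : 2 ≤ s) {full : Fin s × Fin s → Prop} {t : ℕ}
    {r : Conf (Fin s × Fin s)} (h : TourInv L full t r) (ht : t ≤ tourT s) :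
    haltMem s r.mem = false := by
  have h1 : r.mem.mode ≠ .done := by
    intro hd
    have := h.2
    simp [hd] at this
  have h2 := h.1
  unfold tourT at ht
  simp [haltMem, h1, endT, h2]
  omega

theorem TourGlobal.step_eq (hs : 2 ≤ s)
    (hrun : IsRun L initMem (haltMem s) (robotStep s) ident start crash σ) {t : ℕ}
    (h : TourGlobal L ident crash t (σ t)) (ht : t < tourT s) {i : Fin k}
    (hi : Alive crash t i) :
    σ (t + 1) i = applyMove L (σ t i).node
      ({(tourStep s ((grid s).degree (σ t i).node) ((σ t i).inp.getD 4) (σ t i).mem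
          (others crash t (σ t) i)).1 with clk := t + 1},
        (tourStep s ((grid s).degree (σ t i).node) ((σ t i).inp.getD 4) (σ t i).mem
          (others crash t (σ t) i)).2) := by
  rw [hrun.step t i hi ((h.tour i hi).not_halt hs ht.le)]
  have := (h.tour i hi).1
  simp [robotStep, plan, this, ht]

/-- Which robots are taken in at a station in one round. -/
theorem TourGlobal.mode_res_succ (hs : 2 ≤ s)
    (hrun : IsRun L initMem (haltMem s) (robotStep s) ident start crash σ) {t : ℕ}
    (h : TourGlobal L ident crash t (σ t)) (ht : t < tourT s) {i : Fin k}
    (hi : Alive crash t i) (v : Fin s × Fin s) :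
    ((σ (t + 1) i).mem.mode = .res ∧ (σ (t + 1) i).node = v) ↔
      (σ t i).node = v ∧ ((σ t i).mem.mode = .res ∨ ((grid s).degree v ≠ 4 ∧
        Decider ((grid s).degree v) (σ t i).mem ∧
        Joins s ((grid s).degree v) (σ t i).mem (others crash t (σ t) i))) := by
  rw [h.step_eq hs hrun ht hi]
  have hmode := @tourStep_mode_res s ((grid s).degree (σ t i).node) ((σ t i).inp.getD 4)
    (σ t i).mem (others crash t (σ t) i)
  have hstay := @tourStep_stay s ((grid s).degree (σ t i).node) ((σ t i).inp.getD 4)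
    (σ t i).mem (others crash t (σ t) i)
  rw [applyMove_mem]
  simp only
  constructor
  · rintro ⟨h1, h2⟩
    rw [hstay h1] at h2
    change (σ t i).node = v at h2
    subst h2
    exact ⟨rfl, hmode.1 h1⟩
  · rintro ⟨rfl, h2⟩
    refine ⟨hmode.2 h2, ?_⟩
    rw [hstay (hmode.2 h2)]
    rfl

/-- Residents stay put and crashed robots are frozen in their state, so fullness is never lost. -/
theorem TourGlobal.resAt_mono (hs : 2 ≤ s)
    (hrun : IsRun L initMem (haltMem s) (robotStep s) ident start crash σ) {t : ℕ}
    (h : TourGlobal L ident crash t (σ t)) (ht : t < tourT s) (v : Fin s × Fin s) :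
    resAt (σ t) v ⊆ resAt (σ (t + 1)) v := by
  intro i hi
  simp only [resAt, Finset.mem_filter, Finset.mem_univ, true_and] at hi ⊢
  by_cases ha : Alive crash t i
  · exact (h.mode_res_succ hs hrun ht ha v).2 ⟨hi.2, Or.inl hi.1⟩
  · rw [hrun.frozen t i (fun h => ha h.1)]
    exact hi

open Classical in
/-- The robots that have just reached the station `v`. -/
noncomputable def decidersAt (crash : Fin k → ℕ∞) (t : ℕ) (σ : Fin k → Conf (Fin s × Fin s))
    (v : Fin s × Fin s) : Finset (Fin k) :=
  Finset.univ.filter fun i => Alive crash t i ∧ (σ i).node = v ∧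
    Decider ((grid s).degree v) (σ i).mem

theorem TourGlobal.joins_iff (hs : 2 ≤ s) {t : ℕ}
    {S : Fin k → Conf (Fin s × Fin s)}
    (h : TourGlobal L ident crash t S) {v : Fin s × Fin s} (hv : OnB v) {i : Fin k}
    (hi : i ∈ decidersAt crash t S v) :
    Joins s ((grid s).degree v) (S i).mem (others crash t S i) ↔
      ((decidersAt crash t S v).filter fun j => ident j < ident i).card <
        cap v - (aliveResAt crash t S v).card := by
  have hi' := hi
  simp only [decidersAt, Finset.mem_filter, Finset.mem_univ, true_and] at hi'
  obtain ⟨ha, hn, hd⟩ := hi'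
  have hfr : FreshInv L (Full S) t v (S i).inp (S i).mem.c (S i).mem.x (S i).mem.pos := by
    have := (h.tour i ha).2
    simp only [hd.1, hn] at this
    exact this
  unfold Joins
  rw [hfr.capOf_eq hs hv hd]
  rw [countP_others crash t S i _ (aliveResAt crash t S v),
    countP_others crash t S i _ ((decidersAt crash t S v).filter fun j => ident j < ident i)]
  · omega
  · intro j
    simp only [decidersAt, Finset.mem_filter, Finset.mem_univ, true_and, hn, h.id_eq]
    constructor
    · rintro ⟨⟨h1, h2, h3⟩, h4⟩
      exact ⟨⟨fun e => by rw [e] at h4; omega, h1, h2⟩, h3, h4⟩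
    · rintro ⟨⟨h0, h1, h2⟩, h3, h4⟩
      exact ⟨⟨h1, h2, h3⟩, h4⟩
  · intro j
    simp only [aliveResAt, Finset.mem_filter, Finset.mem_univ, true_and, hn]
    constructor
    · rintro ⟨h1, h2, h3⟩
      refine ⟨⟨fun e => ?_, h1, h3⟩, h2⟩
      rw [e, hd.1] at h2
      cases h2
    · rintro ⟨⟨h0, h1, h2⟩, h3⟩
      exact ⟨h1, h3, h2⟩

/-- The invariant of the first part is preserved. -/
theorem TourGlobal.succ (hs : 2 ≤ s) (hL : L.Oriented) (hid : Function.Injective ident)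
    (hrun : IsRun L initMem (haltMem s) (robotStep s) ident start crash σ) {t : ℕ}
    (h : TourGlobal L ident crash t (σ t)) (ht : t < tourT s) :
    TourGlobal L ident crash (t + 1) (σ (t + 1)) := by
  classical
  have hdeg : ∀ {v : Fin s × Fin s}, OnB v → (grid s).degree v ≠ 4 :=
    fun hv h4 => (grid_degree_eq_four hs).1 h4 hv
  let J : Fin s × Fin s → Finset (Fin k) := fun v => (decidersAt crash t (σ t) v).filter fun i =>
    ((decidersAt crash t (σ t) v).filter fun j => ident j < ident i).card <
      cap v - (aliveResAt crash t (σ t) v).card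
  have hJ : ∀ v, (J v).card =
      min (cap v - (aliveResAt crash t (σ t) v).card) (decidersAt crash t (σ t) v).card :=
    fun v => card_filter_rank_lt _ ident hid _
  refine ⟨?_, ?_, ?_⟩
  · intro i
    by_cases ha : Alive crash t i
    · rw [hrun.step t i ha ((h.tour i ha).not_halt hs ht.le), applyMove_mem, robotStep_id,
        h.id_eq]
    · rw [hrun.frozen t i (fun h => ha h.1), h.id_eq]
  · intro i ha
    have ha := ha.pred
    rw [hrun.step t i ha ((h.tour i ha).not_halt hs ht.le)]
    refine (h.tour i ha).step hs hL ht (fun w hw => le_trans hw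
      (Finset.card_le_card (h.resAt_mono hs hrun ht w))) ?_
    intro hb hd hnj
    have hi : i ∈ decidersAt crash t (σ t) (σ t i).node := by
      simp only [decidersAt, Finset.mem_filter, Finset.mem_univ, true_and]
      exact ⟨ha, hd⟩
    -- A rejected robot has at least as many deciders before it as there are free places. All places
    -- are then taken in this round, and the station becomes full.
    rw [h.joins_iff hs hb hi, not_lt] at hnj
    have hcard := hJ (σ t i).node
    have hle := Finset.card_filter_le (decidersAt crash t (σ t) (σ t i).node)
      (fun j => ident j < ident i)
    have hdisj : Disjoint (aliveResAt crash t (σ t) (σ t i).node) (J (σ t i).node) := by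
      rw [Finset.disjoint_left]
      intro j hj hj'
      have hjD := (Finset.mem_filter.1 hj').1
      simp only [aliveResAt, Finset.mem_filter, Finset.mem_univ, true_and] at hj
      simp only [decidersAt, Finset.mem_filter, Finset.mem_univ, true_and] at hjD
      have h1 := hj.2.1
      rw [hjD.2.2.1] at h1
      cases h1
    have hsub : aliveResAt crash t (σ t) (σ t i).node ∪ J (σ t i).node ⊆
        resAt (σ (t + 1)) (σ t i).node := by
      intro j hj
      simp only [resAt, Finset.mem_filter, Finset.mem_univ, true_and]
      rcases Finset.mem_union.1 hj with hj | hj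
      · simp only [aliveResAt, Finset.mem_filter, Finset.mem_univ, true_and] at hj
        exact (h.mode_res_succ hs hrun ht hj.1 _).2 ⟨hj.2.2, Or.inl hj.2.1⟩
      · obtain ⟨hjD, hjr⟩ := Finset.mem_filter.1 hj
        have hjoin := (h.joins_iff hs hb hjD).2 hjr
        simp only [decidersAt, Finset.mem_filter, Finset.mem_univ, true_and] at hjD
        exact (h.mode_res_succ hs hrun ht hjD.1 _).2
          ⟨hjD.2.1, Or.inr ⟨hdeg hb, hjD.2.2, hjoin⟩⟩
    have := Finset.card_le_card hsub
    rw [Finset.card_union_of_disjoint hdisj] at this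
    omega
  · intro v hv
    have hsub : aliveResAt crash (t + 1) (σ (t + 1)) v ⊆
        aliveResAt crash t (σ t) v ∪ J v := by
      intro j hj
      simp only [aliveResAt, Finset.mem_filter, Finset.mem_univ, true_and] at hj
      have ha := hj.1.pred
      obtain ⟨hn, hr⟩ := (h.mode_res_succ hs hrun ht ha v).1 hj.2
      rw [Finset.mem_union]
      rcases hr with hr | hr
      · left
        simp only [aliveResAt, Finset.mem_filter, Finset.mem_univ, true_and]
        exact ⟨ha, hr, hn⟩
      · right
        have hjD : j ∈ decidersAt crash t (σ t) v := by
          simp only [decidersAt, Finset.mem_filter, Finset.mem_univ, true_and]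
          exact ⟨ha, hn, hr.2.1⟩
        exact Finset.mem_filter.2 ⟨hjD, (h.joins_iff hs hv hjD).1 hr.2.2⟩
    have h1 := Finset.card_le_card hsub
    have h2 := Finset.card_union_le (aliveResAt crash t (σ t) v) (J v)
    have h3 := hJ v
    have h4 := h.card_le v hv
    omega

theorem tourGlobal (hs : 2 ≤ s) (hL : L.Oriented) (hid : Function.Injective ident)
    (hrun : IsRun L initMem (haltMem s) (robotStep s) ident start crash σ) {t : ℕ}
    (ht : t ≤ tourT s) : TourGlobal L ident crash t (σ t) := by
  induction t with
  | zero =>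
    refine ⟨fun i => ?_, fun i _ => ?_, fun v _ => ?_⟩
    · rw [hrun.zero]
      rfl
    · rw [hrun.zero]
      exact ⟨rfl, rfl, rfl, rfl, Or.inl ⟨rfl, rfl⟩⟩
    · have : aliveResAt crash 0 (σ 0) v = ∅ := by
        rw [Finset.eq_empty_iff_forall_notMem]
        intro i hi
        simp only [aliveResAt, Finset.mem_filter, Finset.mem_univ, true_and] at hi
        have := hi.2.1
        rw [hrun.zero] at this
        cases this
      rw [this]
      simp
  | succ t ih => exact (ih (by omega)).succ hs hL hid hrun (by omega)

/-- If all stations have been full, then there are not many robots left. -/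
theorem le_card_res (hs : 2 ≤ s) (S : Fin k → Conf (Fin s × Fin s))
    (h : ∀ w, OnB w → Full S w) :
    s ^ 2 ≤ (Finset.univ.filter fun i => (S i).mem.mode = .res).card + s % 2 := by
  classical
  have hsum : ∑ v ∈ Finset.univ.filter (fun v : Fin s × Fin s => OnB v), cap v ≤
      (Finset.univ.filter fun i => (S i).mem.mode = .res).card := by
    calc ∑ v ∈ Finset.univ.filter (fun v : Fin s × Fin s => OnB v), cap v
        ≤ ∑ v ∈ Finset.univ.filter (fun v : Fin s × Fin s => OnB v), (resAt S v).card :=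
          Finset.sum_le_sum fun v hv => h v (Finset.mem_filter.1 hv).2
      _ = ((Finset.univ.filter (fun v : Fin s × Fin s => OnB v)).biUnion (resAt S)).card := by
          rw [Finset.card_biUnion]
          intro v _ w _ hvw
          rw [Function.onFun, Finset.disjoint_left]
          intro i hi hi'
          simp only [resAt, Finset.mem_filter, Finset.mem_univ, true_and] at hi hi'
          exact hvw (hi.2.symm.trans hi'.2)
      _ ≤ _ := by
          apply Finset.card_le_card
          intro i hi
          simp only [Finset.mem_biUnion, resAt, Finset.mem_filter, Finset.mem_univ,
            true_and] at hi ⊢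
          obtain ⟨v, -, hi, -⟩ := hi
          exact hi
  let Z : Finset (Fin s × Fin s) := Finset.univ.filter fun w =>
    ¬ (s % 2 = 0 ∨ (w.1 : ℕ) ≠ s / 2 ∨ (w.2 : ℕ) ≠ s / 2)
  have hZ : Z.card ≤ s % 2 := by
    by_cases he : s % 2 = 0
    · have : Z = ∅ := by
        apply Finset.filter_false_of_mem
        intro w _ hw
        exact hw (Or.inl he)
      rw [this]
      simp
    · have h1 : Z.card ≤ 1 := by
        rw [Finset.card_le_one]
        intro a ha b hb
        simp only [Z, Finset.mem_filter, Finset.mem_univ, true_and] at ha hb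
        apply node_ext <;> omega
      omega
  have hpick : ∀ v : Fin s × Fin s, ∀ r, ∃ w, r < s → IsTarget v r w := by
    intro v r
    by_cases hr : r < s
    · obtain ⟨w, hw⟩ := exists_isTarget hs v hr
      exact ⟨w, fun _ => hw⟩
    · exact ⟨v, fun h => absurd h hr⟩
  choose tgt htgt using hpick
  -- Covering the grid by targets bounds the sum of the capacities from below without computing it.
  have hcover : (Finset.univ : Finset (Fin s × Fin s)) ⊆
      ((Finset.univ.filter (fun v : Fin s × Fin s => OnB v)).biUnion fun v =>
        (Finset.range (cap v)).image (tgt v)) ∪ Z := by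
    intro w _
    rw [Finset.mem_union]
    by_cases hw : s % 2 = 0 ∨ (w.1 : ℕ) ≠ s / 2 ∨ (w.2 : ℕ) ≠ s / 2
    · left
      obtain ⟨v, r, hv, hr, hvr⟩ := exists_station hs w hw
      have hlt : r < s := by
        have := cap_le v
        omega
      have h2 := htgt v r hlt
      simp only [Finset.mem_biUnion, Finset.mem_filter, Finset.mem_univ, true_and,
        Finset.mem_image, Finset.mem_range]
      exact ⟨v, hv, r, hr, node_ext (h2.1.trans hvr.1.symm) (h2.2.trans hvr.2.symm)⟩
    · right
      exact Finset.mem_filter.2 ⟨Finset.mem_univ _, hw⟩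
  have h1 := Finset.card_le_card hcover
  have h2 := Finset.card_union_le ((Finset.univ.filter (fun v : Fin s × Fin s => OnB v)).biUnion
    fun v => (Finset.range (cap v)).image (tgt v)) Z
  have h3 : ((Finset.univ.filter (fun v : Fin s × Fin s => OnB v)).biUnion
      fun v => (Finset.range (cap v)).image (tgt v)).card ≤
      ∑ v ∈ Finset.univ.filter (fun v : Fin s × Fin s => OnB v), cap v := by
    refine le_trans Finset.card_biUnion_le (Finset.sum_le_sum fun v _ => ?_)
    exact le_trans Finset.card_image_le (by simp)
  have h4 : (Finset.univ : Finset (Fin s × Fin s)).card = s ^ 2 := by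
    simp [sq]
  omega

end Global

/-! ### Dispersion -/

section Dispersion

variable {s k : ℕ} {L : PortLabeling (grid s)} {ident : Fin k → ℕ}
  {start : Fin k → Fin s × Fin s} {crash : Fin k → ℕ∞} {σ : ℕ → Fin k → Conf (Fin s × Fin s)}

open Classical in
/-- The rank of robot `i` among the robots at its station. -/
noncomputable def stationRank (ident : Fin k → ℕ) (crash : Fin k → ℕ∞) (t : ℕ)
    (S : Fin k → Conf (Fin s × Fin s)) (i : Fin k) : ℕ :=
  if (S i).mem.mode = .left then s / 2
  else ((aliveResAt crash t S (S i).node).filter fun j => ident j < ident i).card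

theorem stationRank_lt {t : ℕ} {S : Fin k → Conf (Fin s × Fin s)}
    (h : TourGlobal L ident crash t S) {i : Fin k} (ha : Alive crash t i)
    (hm : (S i).mem.mode = .res) (hb : OnB (S i).node) :
    stationRank ident crash t S i < cap (S i).node := by
  classical
  have hi : i ∈ aliveResAt crash t S (S i).node := by
    simp only [aliveResAt, Finset.mem_filter, Finset.mem_univ, true_and]
    exact ⟨ha, hm, trivial⟩
  refine lt_of_lt_of_le ?_ (h.card_le _ hb)
  rw [stationRank, if_neg (by rw [hm]; simp)]
  apply Finset.card_lt_card
  refine ⟨Finset.filter_subset _ _, fun hsub => ?_⟩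
  have := (Finset.mem_filter.1 (hsub hi)).2
  omega

/-- The living residents have ranks below `cap ≤ s / 2`, so the `min` in `launchRank` is inactive
here; it only serves the memory bound. -/
theorem launchRank_eq {t : ℕ} {S : Fin k → Conf (Fin s × Fin s)}
    (h : TourGlobal L ident crash t S) {i : Fin k} (ha : Alive crash t i)
    (hm : ((S i).mem.mode = .res ∧ OnB (S i).node) ∨ (S i).mem.mode = .left) :
    launchRank s (S i).mem (others crash t S i) = stationRank ident crash t S i := by
  classical
  by_cases hl : (S i).mem.mode = .left
  · simp [launchRank, stationRank, hl]
  · obtain ⟨hr, hb⟩ : (S i).mem.mode = .res ∧ OnB (S i).node := by tauto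
    have hlt := stationRank_lt h ha hr hb
    have hcap := cap_le (S i).node
    rw [launchRank, if_neg hl, countP_others crash t S i _
      ((aliveResAt crash t S (S i).node).filter fun j => ident j < ident i)]
    · rw [stationRank, if_neg hl] at hlt ⊢
      omega
    · intro j
      simp only [aliveResAt, Finset.mem_filter, Finset.mem_univ, true_and, h.id_eq]
      constructor
      · rintro ⟨⟨h1, h2, h3⟩, h4⟩
        exact ⟨⟨fun e => by rw [e] at h4; omega, h1, h3⟩, h2, h4⟩
      · rintro ⟨⟨h0, h1, h2⟩, h3, h4⟩
        exact ⟨⟨h1, h3, h2⟩, h4⟩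

theorem stationRank_inj (hid : Function.Injective ident) {t : ℕ}
    {S : Fin k → Conf (Fin s × Fin s)} {i j : Fin k} (hi : Alive crash t i)
    (hj : Alive crash t j) (hmi : (S i).mem.mode = .res) (hmj : (S j).mem.mode = .res)
    (hn : (S i).node = (S j).node)
    (hr : stationRank ident crash t S i = stationRank ident crash t S j) : i = j := by
  classical
  have aux : ∀ a b : Fin k, Alive crash t a → (S a).mem.mode = .res → (S b).mem.mode = .res →
      (S a).node = (S b).node → ident a < ident b →
      stationRank ident crash t S a < stationRank ident crash t S b := by
    intro a b ha hma hmb hab hlt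
    rw [stationRank, stationRank, if_neg (by rw [hma]; simp), if_neg (by rw [hmb]; simp), hab]
    apply Finset.card_lt_card
    refine ⟨fun x hx => ?_, fun hsub => ?_⟩
    · rw [Finset.mem_filter] at hx ⊢
      exact ⟨hx.1, by omega⟩
    · have hmem : a ∈ (aliveResAt crash t S (S b).node).filter fun j => ident j < ident b := by
        simp only [aliveResAt, Finset.mem_filter, Finset.mem_univ, true_and]
        exact ⟨⟨ha, hma, hab⟩, hlt⟩
      have := (Finset.mem_filter.1 (hsub hmem)).2
      omega
  rcases lt_trichotomy (ident i) (ident j) with h | h | h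
  · have := aux i j hi hmi hmj hn h
    omega
  · exact hid h
  · have := aux j i hj hmj hmi hn.symm h
    omega

/-- Robots that have not been taken in at a station: there is at most one, and only if `s` is
odd. -/
theorem left_unique (hs : 2 ≤ s) (hk : k ≤ s ^ 2) {S : Fin k → Conf (Fin s × Fin s)}
    (hfull : ∀ w, OnB w → Full S w) {i : Fin k} (hi : (S i).mem.mode = .left) :
    s % 2 = 1 ∧ ∀ j, (S j).mem.mode = .left → i = j := by
  classical
  have h1 := le_card_res hs S hfull
  have aux : ∀ F : Finset (Fin k), (∀ j ∈ F, (S j).mem.mode = .left) →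
      (Finset.univ.filter fun i => (S i).mem.mode = .res).card + F.card ≤ k := by
    intro F hF
    rw [← Finset.card_union_of_disjoint]
    · exact le_trans (Finset.card_le_univ _) (by simp)
    · rw [Finset.disjoint_left]
      intro j hj hj'
      have h2 := (Finset.mem_filter.1 hj).2
      rw [hF j hj'] at h2
      cases h2
  have h2 := aux {i} (by simpa using hi)
  rw [Finset.card_singleton] at h2
  refine ⟨by omega, fun j hj => ?_⟩
  by_contra hne
  have h3 := aux {i, j} (by
    intro a ha
    rcases Finset.mem_insert.1 ha with rfl | ha
    · exact hi
    · rw [Finset.mem_singleton.1 ha]; exact hj)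
  rw [Finset.card_pair hne] at h3
  omega

/-- The targets of the robots are distinct. -/
theorem exists_targets (hs : 2 ≤ s) (hL : L.Oriented) (hid : Function.Injective ident)
    (hk : k ≤ s ^ 2)
    (hrun : IsRun L initMem (haltMem s) (robotStep s) ident start crash σ) :
    ∃ τ : Fin k → Fin s × Fin s,
      (∀ i j, Alive crash (tourT s) i → Alive crash (tourT s) j → τ i = τ j → i = j) ∧
      ∀ i, Alive crash (tourT s) i → FinalInv L (τ i) (tourT s + 1) (σ (tourT s + 1) i) := by
  have hG := tourGlobal hs hL hid hrun (le_refl (tourT s))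
  have hset := fun i hi => (hG.tour i hi).settled hs
  have hpick : ∀ i, ∃ w, Alive crash (tourT s) i →
      IsTarget (σ (tourT s) i).node (stationRank ident crash (tourT s) (σ (tourT s)) i) w := by
    intro i
    by_cases ha : Alive crash (tourT s) i
    · have hlt : stationRank ident crash (tourT s) (σ (tourT s)) i < s := by
        rcases hset i ha with ⟨h1, h2⟩ | ⟨h1, -⟩
        · have := stationRank_lt hG ha h1 h2
          have := cap_le (σ (tourT s) i).node
          omega
        · rw [stationRank, if_pos h1]
          omega
      obtain ⟨w, hw⟩ := exists_isTarget hs (σ (tourT s) i).node hlt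
      exact ⟨w, fun _ => hw⟩
    · exact ⟨start i, fun h => absurd h ha⟩
  choose τ hτ using hpick
  refine ⟨τ, ?_, ?_⟩
  · intro i j hi hj hij
    have ti := hτ i hi
    have tj := hτ j hj
    rw [← hij] at tj
    rcases hset i hi with ⟨i1, i2⟩ | ⟨i1, i2, i3⟩ <;> rcases hset j hj with ⟨j1, j2⟩ | ⟨j1, j2, j3⟩
    · obtain ⟨e1, e2⟩ := isTarget_inj i2 j2 (stationRank_lt hG hi i1 i2)
        (stationRank_lt hG hj j1 j2) ti tj
      exact stationRank_inj hid hi hj i1 j1 e1 e2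
    · rw [stationRank, if_pos j1] at tj
      exact (not_isTarget_center i2 j2 (stationRank_lt hG hi i1 i2)
        (left_unique hs hk j3 j1).1 ti tj).elim
    · rw [stationRank, if_pos i1] at ti
      exact (not_isTarget_center j2 i2 (stationRank_lt hG hj j1 j2)
        (left_unique hs hk i3 i1).1 tj ti).elim
    · exact (left_unique hs hk i3 i1).2 j j1
  · intro i hi
    have hclk := (hG.tour i hi).1
    rw [hrun.step _ i hi ((hG.tour i hi).not_halt hs le_rfl)]
    have hrank := launchRank_eq hG hi (i := i) (by
      rcases hset i hi with h | h
      · exact Or.inl h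
      · exact Or.inr h.1)
    have hplan : robotStep s ((grid s).degree (σ (tourT s) i).node) (σ (tourT s) i).inp
        (σ (tourT s) i).mem (others crash (tourT s) (σ (tourT s)) i) =
        ({(launch ((grid s).degree (σ (tourT s) i).node) (σ (tourT s) i).mem
            (stationRank ident crash (tourT s) (σ (tourT s)) i)).1 with clk := tourT s + 1},
          (launch ((grid s).degree (σ (tourT s) i).node) (σ (tourT s) i).mem
            (stationRank ident crash (tourT s) (σ (tourT s)) i)).2) := by
      simp [robotStep, plan, hclk, hrank]
    rw [hplan]
    rcases hset i hi with ⟨h1, h2⟩ | ⟨h1, h2, h3⟩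
    · have := lt_of_lt_cap h2 (stationRank_lt hG hi h1 h2)
      exact launch_finalInv hs h2 (hτ i hi) (by omega)
    · refine launch_finalInv hs h2.onB (hτ i hi) ?_
      -- `2 * (s / 2) < s` holds because `s` is odd.
      have := (left_unique hs hk h3 h1).1
      rw [stationRank, if_pos h1]
      omega

/-- The program solves dispersion. -/
theorem dispersed_of_isRun (hs : 2 ≤ s) (hL : L.Oriented) (hid : Function.Injective ident)
    (hk : k ≤ s ^ 2)
    (hrun : IsRun L initMem (haltMem s) (robotStep s) ident start crash σ) {t : ℕ}
    (ht : endT s ≤ t) :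
    (∀ i, Alive crash t i → haltMem s (σ t i).mem = true) ∧
      ∀ i j, Alive crash t i → Alive crash t j → (σ t i).node = (σ t j).node → i = j := by
  obtain ⟨τ, hinj, hτ⟩ := exists_targets hs hL hid hk hrun
  -- Each robot now moves independently of the others: `finalStep` does not read their memories.
  have hlate : ∀ d i, Alive crash (tourT s + 1 + d) i → Alive crash (tourT s) i ∧
      FinalInv L (τ i) (tourT s + 1 + d) (σ (tourT s + 1 + d) i) := by
    intro d
    induction d with
    | zero =>
      intro i hi
      exact ⟨hi.pred, hτ i hi.pred⟩
    | succ d ih =>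
      intro i hi
      have hi' : Alive crash (tourT s + 1 + d) i := Alive.pred hi
      obtain ⟨h1, h2⟩ := ih i hi'
      refine ⟨h1, ?_⟩
      rw [← add_assoc]
      by_cases hd : (σ (tourT s + 1 + d) i).mem.mode = .done
      · rw [hrun.frozen _ i (by simp [haltMem, hd])]
        simp only [FinalInv, hd] at h2 ⊢
        exact h2
      · have hclk := h2.clk_eq hd
        have hlt : tourT s + 1 + d < 50 * s := by
          by_contra hge
          exact hd (h2.eq_done hs (by omega))
        rw [hrun.step _ i hi' (by simp [haltMem, hd, hclk, endT]; omega)]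
        exact h2.step hs hL (by omega) hd _
  have hend : ∀ i, Alive crash t i → Alive crash (tourT s) i ∧
      (σ t i).mem.mode = .done ∧ (σ t i).node = τ i := by
    intro i hi
    unfold endT at ht
    obtain ⟨d, rfl⟩ : ∃ d, t = tourT s + 1 + d := ⟨t - (tourT s + 1), by unfold tourT; omega⟩
    obtain ⟨h1, h2⟩ := hlate d i hi
    have hd := h2.eq_done hs (by omega)
    refine ⟨h1, hd, ?_⟩
    simpa only [FinalInv, hd] using h2
  refine ⟨fun i hi => by simp [haltMem, (hend i hi).2.1], fun i j hi hj hij => ?_⟩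
  refine hinj i j (hend i hi).1 (hend j hj).1 ?_
  rw [← (hend i hi).2.2, ← (hend j hj).2.2, hij]

end Dispersion

/-! ### Memory -/

/-- Bounds on the memory contents. -/
def GoodMem (s B : ℕ) (m : Mem) : Prop :=
  m.id < 2 ^ B ∧ m.clk ≤ endT s ∧ m.c ≤ m.clk + s + 4 ∧ m.x ≤ m.clk + s + 4 ∧
    m.pos ≤ m.clk + s + 4

/-- Counters grow by at most one per round or are reset to a port or a rank, which the slack `s + 4`
covers. Halting at `endT` bounds the clock without any knowledge of the run. -/
theorem GoodMem.step {s B δ : ℕ} {inp : Option ℕ} {m : Mem} (o : Multiset Mem)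
    (hδ : δ ≤ 4) (hinp : ∀ p ∈ inp, p < δ) (h : GoodMem s B m) (hh : haltMem s m = false) :
    GoodMem s B (robotStep s δ inp m o).1 := by
  have hid := robotStep_id s δ inp m o
  obtain ⟨h1, h2, h3, h4, h5⟩ := h
  have hclk : m.clk < endT s := by
    simp [haltMem] at hh
    omega
  have he : inp.getD 4 ≤ 4 := by
    cases inp with
    | none => simp
    | some p =>
      have := hinp p rfl
      simp only [Option.getD_some]
      omega
  have hx : newX δ m ≤ m.x + 1 := by
    unfold newX
    split_ifs <;> omega
  have hp : newPos δ m ≤ m.pos + 1 := by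
    unfold newPos
    split_ifs <;> omega
  have hr : launchRank s m o ≤ s / 2 := by
    unfold launchRank
    split_ifs <;> omega
  have key : (plan s δ (inp.getD 4) m o).1.c ≤ m.clk + s + 5 ∧
      (plan s δ (inp.getD 4) m o).1.x ≤ m.clk + s + 5 ∧
      (plan s δ (inp.getD 4) m o).1.pos ≤ m.clk + s + 5 := by
    unfold plan
    split_ifs
    · unfold tourStep
      split <;> (try split_ifs) <;> refine ⟨?_, ?_, ?_⟩ <;> simp only <;> omega
    · unfold launch
      split_ifs <;> refine ⟨?_, ?_, ?_⟩ <;> simp only <;> omega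
    · unfold finalStep inward
      split <;> (try split_ifs) <;> refine ⟨?_, ?_, ?_⟩ <;> simp only <;> omega
  refine ⟨by rw [hid]; exact h1, ?_, ?_, ?_, ?_⟩ <;> simp only [robotStep] <;> omega

/-- Memory contents within given bounds can be stored in few bits. -/
theorem exists_encoding (s B w : ℕ) (hs : 2 ≤ s) (hw : 64 * s < 2 ^ w) :
    ∃ (enc : Mem → Memory (B + 4 + 4 * w)) (dec : Memory (B + 4 + 4 * w) → Mem),
      ∀ m, GoodMem s B m → dec (enc m) = m := by
  classical
  have hcard : Fintype.card (Fin (2 ^ B) × Mode × (Fin 4 → Fin (2 ^ w))) ≤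
      Fintype.card (Memory (B + 4 + 4 * w)) := by
    have h1 : Fintype.card Mode = 11 := rfl
    simp only [Fintype.card_prod, Fintype.card_fin, Fintype.card_fun, h1, Fintype.card_bool]
    rw [pow_add, pow_add, mul_assoc, ← pow_mul, mul_comm w 4]
    gcongr
    -- The 11 modes fit into 4 bits.
    norm_num
  obtain ⟨f⟩ := Function.Embedding.nonempty_of_card_le hcard
  have hB : 0 < 2 ^ B := by positivity
  have hW : 0 < 2 ^ w := by positivity
  have : NeZero (2 ^ B) := ⟨hB.ne'⟩
  have : NeZero (2 ^ w) := ⟨hW.ne'⟩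
  let e : Mem → Fin (2 ^ B) × Mode × (Fin 4 → Fin (2 ^ w)) := fun m =>
    (Fin.ofNat _ m.id, m.mode, ![Fin.ofNat _ m.clk, Fin.ofNat _ m.c, Fin.ofNat _ m.x,
      Fin.ofNat _ m.pos])
  let d : Fin (2 ^ B) × Mode × (Fin 4 → Fin (2 ^ w)) → Mem := fun a =>
    ⟨a.1, a.2.2 0, a.2.1, a.2.2 1, a.2.2 2, a.2.2 3⟩
  have : Nonempty (Fin (2 ^ B) × Mode × (Fin 4 → Fin (2 ^ w))) := ⟨e (initMem 0)⟩
  refine ⟨fun m => f (e m), fun μ => d (Function.invFun f μ), fun m hm => ?_⟩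
  simp only [Function.leftInverse_invFun f.injective (e m)]
  obtain ⟨h1, h2, h3, h4, h5⟩ := hm
  -- The clock is at most `60 * s`, and the other counters are at most `61 * s + 4 < 64 * s`.
  unfold endT at h2
  ext
  · exact Nat.mod_eq_of_lt h1
  · exact Nat.mod_eq_of_lt (by omega)
  · rfl
  · exact Nat.mod_eq_of_lt (by omega)
  · exact Nat.mod_eq_of_lt (by omega)
  · exact Nat.mod_eq_of_lt (by omega)

theorem memory_bound {n : ℕ} (c : ℕ) (hn : 4 ≤ n) :
    ((c * Nat.size n + 4 + 4 * (6 + Nat.size n) : ℕ) : ℝ) ≤ (2 * c + 100) * Real.logb 2 n := by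
  have h2 : (2 : ℝ) ≤ Real.logb 2 n := by
    rw [Real.le_logb_iff_rpow_le one_lt_two (by positivity)]
    norm_num
    exact_mod_cast hn
  have h1 : (Nat.size n : ℝ) ≤ Real.logb 2 n + 1 := by
    obtain ⟨z, hz⟩ : ∃ z, Nat.size n = z + 1 := by
      refine ⟨Nat.size n - 1, ?_⟩
      have : 0 < Nat.size n := Nat.size_pos.2 (by omega)
      omega
    have hp : 2 ^ z ≤ n := Nat.lt_size.1 (by omega)
    have : (z : ℝ) ≤ Real.logb 2 n := by
      rw [Real.le_logb_iff_rpow_le one_lt_two (by positivity), Real.rpow_natCast]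
      exact_mod_cast hp
    rw [hz]
    push_cast
    linarith
  have hc : (0 : ℝ) ≤ c := Nat.cast_nonneg c
  push_cast
  have h3 : (c : ℝ) * Nat.size n ≤ c * (2 * Real.logb 2 n) :=
    mul_le_mul_of_nonneg_left (by linarith) hc
  linarith

theorem mainTheorem1 (c : ℕ) :
    ∃ C : ℝ, ∀ n s : ℕ, 2 ≤ s → n = s ^ 2 →
      ∃ b : ℕ, (b : ℝ) ≤ C * Real.logb 2 n ∧
      ∃ A : RobotProgram b,
        ∀ L : PortLabeling (grid s), L.Oriented →
        ∀ k f : ℕ, f ≤ k → k ≤ n →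
        ∀ ident : Fin k → ℕ, Function.Injective ident →
          (∀ i, Nat.size (ident i) ≤ c * Nat.size k) →
        ∀ start : Fin k → Fin s × Fin s,
        ∀ crash : Fin k → ℕ∞, {i | crash i ≠ ⊤}.ncard ≤ f →
        ∀ t : ℕ, C * Real.sqrt n ≤ t →
          DispersedAt A crash t (execution L A ident start crash t) := by
  -- One constant for both bounds: it covers the bits by `memory_bound`, and it exceeds the 60 of
  -- `endT`.
  refine ⟨2 * c + 100, fun n s hs hn => ?_⟩
  have hn4 : 4 ≤ n := by
    rw [hn]
    nlinarith
  refine ⟨c * Nat.size n + 4 + 4 * (6 + Nat.size n), memory_bound c hn4, ?_⟩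
  have hw : 64 * s < 2 ^ (6 + Nat.size n) := by
    have h1 : n < 2 ^ Nat.size n := Nat.lt_size_self n
    have h2 : s ≤ n := by
      rw [hn]
      nlinarith
    rw [pow_add]
    norm_num
    omega
  obtain ⟨enc, dec, henc⟩ := exists_encoding s (c * Nat.size n) (6 + Nat.size n) hs hw
  refine ⟨liftProgram enc dec initMem (haltMem s) (robotStep s), ?_⟩
  intro L hL k f _ hk ident hid hsize start crash _ t ht
  have hrun := isRun_confOf L enc dec initMem (haltMem s) (robotStep s) ident start crash
    (GoodMem s (c * Nat.size n)) henc
    (fun i => by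
      refine ⟨Nat.size_le.1 (le_trans (hsize i) (Nat.mul_le_mul_left c (Nat.size_le_size hk))),
        ?_, ?_, ?_, ?_⟩ <;> simp only [initMem] <;> omega)
    (fun v inp m o hinp hm hh => GoodMem.step o
      (by have := grid_degree_cases hs v; omega) hinp hm hh)
  have ht' : endT s ≤ t := by
    have h1 : Real.sqrt n = s := by
      rw [hn]
      push_cast
      exact Real.sqrt_sq (Nat.cast_nonneg s)
    rw [h1] at ht
    have hc : (0 : ℝ) ≤ c * s := by positivity
    have hs0 : (0 : ℝ) ≤ s := Nat.cast_nonneg s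
    have : (60 * s : ℝ) ≤ t := by nlinarith
    unfold endT
    exact_mod_cast this
  exact dispersed_of_isRun hs hL hid (hn ▸ hk) hrun ht'
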